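/- Let $\phi,\psi:[0,1]\to\mathbb R$ be continuous on $[0,1]$ and twice continuously differentiable on $(0,1]$ (one-sided at $x=1$), such that - $\phi$ is concave, $\phi(0)=\phi(1)=0$ and $-1<\phi'(1)<0$; - $\psi$ is convex, $\psi(1)=0$, $\psi'(1)<0$, and $\psi''(1)-\phi''(1)>0$; - the function $x\mapsto \phi'(x)+\phi'(1)-\phi(x)\,[\psi'(x)+\psi'(1)]/\psi(x)$ is decreasing (not necessarily strictly) on $(0,1)$; - the limit $\lim_{x\to0^+}\phi(x)/x$ is finite. Let $c_0\ge 0$ be an integrable function on $(0,1)$, and put $w_0(x)=\int_x^1c_0(y)\,dy$, $h_0(x)=\int_x^1w_0(y)\,dy$. Assume $w_0(x)>0$ for $0\le x<1$, $\int_0^1w_0(x)\,dx=1$, and that the data is critical, i.e. $$\lim_{x\to1^-}\frac{c_0(x)\,h_0(x)}{w_0(x)^2}=1 .$$ Then there is a constant $C$, depending only on $\phi,\psi$ and $c_0$, such that $\kappa(t)\le C$ for all $t\ge0$ whenever $(w,\kappa)$, with $\kappa:[0,\infty)\to(0,\infty)$ continuous, solves $$\frac{\partial w}{\partial t}+[\phi(x)-\kappa(t)\psi(x)]\frac{\partial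 w}{\partial x}=w,\quad 0\le x<1,\ t\ge0,\qquad w(x,0)=w_0(x),\qquad \int_0^1w(x,t)\,dx=1\quad(t\ge0).$$ Here the differential equation is understood along characteristics: $\frac{d}{ds}w(\gamma(s),s)=w(\gamma(s),s)$ on $[a,b]$ for every $0\le a<b$ and every curve $\gamma:[a,b]\to[0,1)$ with $\gamma'(s)=\phi(\gamma(s))-\kappa(s)\psi(\gamma(s))$. -/

import Mathlib

open Set Filter Topology

namespace LSW

noncomputable section

/-- First derivative on `(0,1]` (one-sided at the right end point `1`). -/
def d1 (f : ℝ → ℝ) (x : ℝ) : ℝ := derivWithin f (Ioc 0 1) x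

/-- Second derivative on `(0,1]` (one-sided at the right end point `1`). -/
def d2 (f : ℝ → ℝ) (x : ℝ) : ℝ := iteratedDerivWithin 2 f (Ioc 0 1) x

/-- The standing assumptions on the coefficients: `φ, ψ` are continuous on `[0,1]` and `C²` on
`(0,1]`; `φ` is concave with `φ(0) = φ(1) = 0`, `-1 < φ'(1) < 0`; `ψ` is convex with `ψ(1) = 0`,
`ψ'(1) < 0`; and `ψ''(1) - φ''(1) > 0`. -/
structure IsCoefficientPair (φ ψ : ℝ → ℝ) : Prop where
  φ_continuousOn : ContinuousOn φ (Icc 0 1)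
  φ_contDiffOn : ContDiffOn ℝ 2 φ (Ioc 0 1)
  φ_concaveOn : ConcaveOn ℝ (Icc 0 1) φ
  φ_zero : φ 0 = 0
  φ_one : φ 1 = 0
  φ_slope_gt : -1 < d1 φ 1
  φ_slope_neg : d1 φ 1 < 0
  ψ_continuousOn : ContinuousOn ψ (Icc 0 1)
  ψ_contDiffOn : ContDiffOn ℝ 2 ψ (Ioc 0 1)
  ψ_convexOn : ConvexOn ℝ (Icc 0 1) ψ
  ψ_one : ψ 1 = 0
  ψ_slope_neg : d1 ψ 1 < 0
  curvature_pos : 0 < d2 ψ 1 - d2 φ 1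

/-- The function `Γ(x) = φ'(x) + φ'(1) - φ(x) [ψ'(x) + ψ'(1)] / ψ(x)`. -/
def Gam (φ ψ : ℝ → ℝ) (x : ℝ) : ℝ :=
  d1 φ x + d1 φ 1 - φ x * (d1 ψ x + d1 ψ 1) / ψ x

/-- `(tail f) x = ∫_x^1 f`. For a density `c` on `(0,1)`, `w = tail c` and `h = tail (tail c)`. -/
def tail (f : ℝ → ℝ) (x : ℝ) : ℝ := ∫ y in x..1, f y

/-- The beta function `β = c h / w²` of a density `c`. -/
def betaFn (c : ℝ → ℝ) (x : ℝ) : ℝ := c x * tail (tail c) x / (tail c x) ^ 2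

/-- Admissible initial density `c₀` on `(0,1)`: nonnegative, integrable, with `w₀ = tail c₀`
strictly positive on `[0,1)` and normalised by `∫_0^1 w₀ = 1`. -/
structure IsInitialDensity (c₀ : ℝ → ℝ) : Prop where
  nonneg : ∀ x ∈ Ioo (0 : ℝ) 1, 0 ≤ c₀ x
  integrable : IntervalIntegrable c₀ MeasureTheory.volume 0 1
  tail_pos : ∀ x ∈ Ico (0 : ℝ) 1, 0 < tail c₀ x
  mass : ∫ x in (0 : ℝ)..1, tail c₀ x = 1

/-- `γ` is a characteristic on the time interval `[a,b]`: it takes values in `[0,1)` and solves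
`dγ/ds = φ(γ(s)) - κ(s) ψ(γ(s))`. -/
def IsCharacteristic (φ ψ κ : ℝ → ℝ) (a b : ℝ) (γ : ℝ → ℝ) : Prop :=
  ∀ s ∈ Icc a b, γ s ∈ Ico (0 : ℝ) 1 ∧
    HasDerivWithinAt γ (φ (γ s) - κ s * ψ (γ s)) (Icc a b) s

/-- `(w, κ)` solves
`∂w/∂t + [φ(x) - κ(t) ψ(x)] ∂w/∂x = w` for `0 ≤ x < 1`, `t ≥ 0`, with `w(·,0) = w₀` and the
conservation law `∫_0^1 w(x,t) dx = 1`. Since `w₀` need not be differentiable, the first-order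
equation is read along its characteristics: `d/ds w(γ(s),s) = w(γ(s),s)` for every characteristic
`γ` (for a `C¹` function `w` this is the chain rule applied to the equation). Positivity of `κ`
makes `x = 0` an outflow boundary, so that no boundary condition is imposed there. -/
structure IsSolution (φ ψ w₀ : ℝ → ℝ) (w : ℝ → ℝ → ℝ) (κ : ℝ → ℝ) : Prop where
  κ_continuousOn : ContinuousOn κ (Ici 0)
  κ_pos : ∀ t, 0 ≤ t → 0 < κ t
  initial : ∀ x ∈ Ico (0 : ℝ) 1, w x 0 = w₀ x
  transport : ∀ (a b : ℝ) (γ : ℝ → ℝ), 0 ≤ a → a < b → IsCharacteristic φ ψ κ a b γ →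
    ∀ s ∈ Icc a b, HasDerivWithinAt (fun r => w (γ r) r) (w (γ s) s) (Icc a b) s
  conservation : ∀ t, 0 ≤ t → ∫ x in (0 : ℝ)..1, w x t = 1

end

end LSW

/-!
The rate `κ` is controlled by the outflow value `m(s) = w(0, s)`. Since `w(·, s)` is decreasing with
integral `1`, `m ≥ 1`, and the mass balance bounds `κ` in terms of `1 / (m - 1)`
(`SolutionData.κ_le_of_le_w_zero`), so it suffices to keep `m` away from `1`, i.e. to prevent the
solution from concentrating at `x = 1`. One shows that `m` does not decrease at any time at which
`m = 1 + δ`, for a small `δ` depending only on the data.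

With `b = -ψ'(1)`, put `y = ∫_0^x b / ψ` (`logCoord`) and `p = exp y` (`expCoord`); `p` is comparable
to `1 / (1 - x)`. A characteristic satisfies `dp/ds = Φ(p) - b κ p` where `Φ' = Γ - φ'(1)`. Thus `Γ`
decreasing means that `Φ` is concave, and the backward flow of the characteristics is convex in the
coordinate `p` (`IsLogChar.exp_convex`, `FlowData.foot_convex`), whatever the rate `κ` is. This
convexity is obtained from a comparison argument for differential inequalities, without
differentiating the flow with respect to its initial value. The limit of `φ(x) / x` at `0` makes the
velocity field Lipschitz in the coordinate `y`, which yields existence, uniqueness and monotonicity of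
the backward flow.

Along characteristics `w(x, s) = exp s * w₀(F_s x)`, where `F_s` is the backward flow to time `0`.
The critical condition is used only through `1/2 ≤ β ≤ 2` near `1`: it makes the slopes of `w₀` in
the coordinate `p` comparable from left to right wherever `w₀` varies by at most a fixed factor
(`IsInitialDensity.exists_slope_comparison`). Together with the convexity of `F_s`, a drop of
`w(·, s)` across `[0, y]` forces a drop of order `1 / (y (1 - x))` times its size at
every `x` where `w(x, s)` is still close to `m`. Integrating in `x` against
`∫_0^1 (m - w(x, s)) dx = m - 1` gains a factor `log (1 / δ)`
(`SolutionData.log_mul_drop_le`): the drop is much smaller than `y (m - 1)`. On the other hand the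
mass balance bounds `(m - 1) ∫_s^t κ` by a constant times `t - s` (`SolutionData.cumul_sub_mul_le`),
so that the loss of `m` by outflow is smaller than its gain by the factor `exp (t - s)`
(`SolutionData.eventually_w_zero_ge`). This requires that the characteristic exiting at time `s`
started close to `1`; otherwise `s` is bounded and `m - 1` is bounded below directly
(`SolutionData.exists_lower_bound_of_foot_le`).
-/

namespace LSW

/-! ### Elementary bounds for the coefficients -/

section Coefficients

variable {φ ψ : ℝ → ℝ}

theorem hasDerivWithinAt_d1 {f : ℝ → ℝ} (hf : ContDiffOn ℝ 2 f (Ioc 0 1)) {x : ℝ}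
    (hx : x ∈ Ioc (0 : ℝ) 1) : HasDerivWithinAt f (d1 f x) (Ioc 0 1) x :=
  (hf.differentiableOn (by norm_num) x hx).hasDerivWithinAt

theorem hasDerivAt_d1 {f : ℝ → ℝ} (hf : ContDiffOn ℝ 2 f (Ioc 0 1)) {x : ℝ}
    (hx : x ∈ Ioo (0 : ℝ) 1) : HasDerivAt f (d1 f x) x :=
  (hasDerivWithinAt_d1 hf ⟨hx.1, hx.2.le⟩).hasDerivAt (Ioc_mem_nhds hx.1 hx.2)

theorem hasDerivWithinAt_d1_one {f : ℝ → ℝ} (hf : ContDiffOn ℝ 2 f (Ioc 0 1)) :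
    HasDerivWithinAt f (d1 f 1) (Iio 1) 1 := by
  refine (hasDerivWithinAt_d1 hf (by simp)).mono_of_mem_nhdsWithin ?_
  exact mem_of_superset (Ioo_mem_nhdsLT one_pos) Ioo_subset_Ioc_self

namespace IsCoefficientPair

variable (h : IsCoefficientPair φ ψ)
include h

theorem φ_nonneg {x : ℝ} (hx : x ∈ Icc (0 : ℝ) 1) : 0 ≤ φ x := by
  have := h.φ_concaveOn.2 (left_mem_Icc.2 zero_le_one) (right_mem_Icc.2 zero_le_one)
    (sub_nonneg.2 hx.2) hx.1 (by ring)
  simpa [h.φ_zero, h.φ_one] using this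

theorem φ_le {x : ℝ} (hx : x ∈ Icc (0 : ℝ) 1) : φ x ≤ -d1 φ 1 * (1 - x) := by
  rcases hx.2.eq_or_lt with rfl | h1
  · simp [h.φ_one]
  have := h.φ_concaveOn.le_slope_of_hasDerivWithinAt_Iio hx (right_mem_Icc.2 zero_le_one) h1
    (hasDerivWithinAt_d1_one h.φ_contDiffOn)
  rw [slope_def_field, h.φ_one, le_div_iff₀ (by linarith)] at this
  linarith

theorem le_ψ {x : ℝ} (hx : x ∈ Icc (0 : ℝ) 1) : -d1 ψ 1 * (1 - x) ≤ ψ x := by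
  rcases hx.2.eq_or_lt with rfl | h1
  · simp [h.ψ_one]
  have := h.ψ_convexOn.slope_le_of_hasDerivWithinAt_Iio hx (right_mem_Icc.2 zero_le_one) h1
    (hasDerivWithinAt_d1_one h.ψ_contDiffOn)
  rw [slope_def_field, h.ψ_one, div_le_iff₀ (by linarith)] at this
  linarith

theorem ψ_le {x : ℝ} (hx : x ∈ Icc (0 : ℝ) 1) : ψ x ≤ ψ 0 * (1 - x) := by
  have := h.ψ_convexOn.2 (left_mem_Icc.2 zero_le_one) (right_mem_Icc.2 zero_le_one)
    (sub_nonneg.2 hx.2) hx.1 (by ring)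
  simpa [h.ψ_one, mul_comm] using this

theorem b_pos : 0 < -d1 ψ 1 := by linarith [h.ψ_slope_neg]

theorem b_le : -d1 ψ 1 ≤ ψ 0 := by simpa using h.le_ψ (left_mem_Icc.2 zero_le_one)

theorem ψ_zero_pos : 0 < ψ 0 := h.b_pos.trans_le h.b_le

theorem ψ_pos {x : ℝ} (hx : x ∈ Ico (0 : ℝ) 1) : 0 < ψ x :=
  (mul_pos h.b_pos (by linarith [hx.2])).trans_le (h.le_ψ ⟨hx.1, hx.2.le⟩)

theorem d1_ψ_nonpos {x : ℝ} (hx : x ∈ Ioo (0 : ℝ) 1) : d1 ψ x ≤ 0 := by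
  have hx' : x ∈ Icc (0 : ℝ) 1 := ⟨hx.1.le, hx.2.le⟩
  have := h.ψ_convexOn.le_slope_of_hasDerivAt hx' (right_mem_Icc.2 zero_le_one) hx.2
    (hasDerivAt_d1 h.ψ_contDiffOn hx)
  rw [slope_def_field, h.ψ_one, le_div_iff₀ (by linarith [hx.2])] at this
  have := h.ψ_pos ⟨hx.1.le, hx.2⟩
  nlinarith [hx.2]

theorem neg_le_x_mul_d1_ψ {x : ℝ} (hx : x ∈ Ioo (0 : ℝ) 1) : -ψ 0 ≤ x * d1 ψ x := by
  have hx' : x ∈ Icc (0 : ℝ) 1 := ⟨hx.1.le, hx.2.le⟩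
  have := h.ψ_convexOn.slope_le_of_hasDerivAt (left_mem_Icc.2 zero_le_one) hx' hx.1
    (hasDerivAt_d1 h.ψ_contDiffOn hx)
  rw [slope_def_field, div_le_iff₀ (by linarith [hx.1])] at this
  have := h.ψ_pos ⟨hx.1.le, hx.2⟩
  nlinarith [hx.2]

theorem le_d1_φ {x : ℝ} (hx : x ∈ Ioo (0 : ℝ) 1) : d1 φ 1 ≤ d1 φ x := by
  have hx' : x ∈ Icc (0 : ℝ) 1 := ⟨hx.1.le, hx.2.le⟩
  have h1 := h.φ_concaveOn.slope_le_of_hasDerivAt hx' (right_mem_Icc.2 zero_le_one) hx.2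
    (hasDerivAt_d1 h.φ_contDiffOn hx)
  exact (h.φ_concaveOn.le_slope_of_hasDerivWithinAt_Iio hx' (right_mem_Icc.2 zero_le_one) hx.2
    (hasDerivWithinAt_d1_one h.φ_contDiffOn)).trans h1

/-- By concavity `φ x / x` increases to its limit at `0`. -/
theorem φ_le_of_tendsto {L : ℝ} (hL : Tendsto (fun x => φ x / x) (𝓝[>] 0) (𝓝 L)) {x : ℝ}
    (hx : x ∈ Ioc (0 : ℝ) 1) : φ x ≤ L * x := by
  rw [← div_le_iff₀ hx.1]
  refine ge_of_tendsto hL ?_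
  filter_upwards [Ioo_mem_nhdsGT hx.1] with z hz
  have := h.φ_concaveOn.2 (left_mem_Icc.2 zero_le_one) (⟨hx.1.le, hx.2⟩ : x ∈ Icc (0 : ℝ) 1)
    (show 0 ≤ 1 - z / x by rw [sub_nonneg, div_le_one hx.1]; exact hz.2.le)
    (show 0 ≤ z / x from div_nonneg hz.1.le hx.1.le) (by ring)
  have hx0 := hx.1.ne'
  simp only [h.φ_zero, smul_eq_mul, mul_zero, zero_add, div_mul_cancel₀ _ hx0] at this
  rw [div_le_div_iff₀ hx.1 hz.1]
  calc φ x * z = z / x * φ x * x := by field_simp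
    _ ≤ φ z * x := by gcongr; exact hx.1.le

theorem d1_φ_le {L : ℝ} (hL : Tendsto (fun x => φ x / x) (𝓝[>] 0) (𝓝 L)) {x : ℝ}
    (hx : x ∈ Ioo (0 : ℝ) 1) : d1 φ x ≤ L := by
  have hx' : x ∈ Icc (0 : ℝ) 1 := ⟨hx.1.le, hx.2.le⟩
  have h1 := h.φ_concaveOn.le_slope_of_hasDerivAt (left_mem_Icc.2 zero_le_one) hx' hx.1
    (hasDerivAt_d1 h.φ_contDiffOn hx)
  rw [slope_def_field, h.φ_zero, sub_zero, sub_zero] at h1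
  refine h1.trans ?_
  rw [div_le_iff₀ hx.1]
  exact h.φ_le_of_tendsto hL ⟨hx.1, hx.2.le⟩

/-- The quantity `φ' - φ ψ' / ψ`, i.e. `ψ (φ / ψ)'`, is bounded: this makes the velocity field
Lipschitz in the logarithmic coordinate. -/
theorem exists_bound_wronskian (hφ0 : ∃ L : ℝ, Tendsto (fun x => φ x / x) (𝓝[>] 0) (𝓝 L)) :
    ∃ K : ℝ, 0 ≤ K ∧ ∀ x ∈ Ioo (0 : ℝ) 1, |d1 φ x - φ x * d1 ψ x / ψ x| ≤ K := by
  obtain ⟨L, hL⟩ := hφ0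
  have hb := h.b_pos
  have hψ0 := h.ψ_zero_pos
  have ha : 0 < -d1 φ 1 := by linarith [h.φ_slope_neg]
  have hL0 : 0 ≤ L := by
    have := h.φ_le_of_tendsto hL (x := 1) (by simp)
    simpa [h.φ_one] using this
  have hA : 0 ≤ 2 * L * ψ 0 / (-d1 ψ 1) := by positivity
  have hB : 0 ≤ 2 * (-d1 φ 1) * ψ 0 / (-d1 ψ 1) := by positivity
  refine ⟨L + (-d1 φ 1) + 2 * L * ψ 0 / (-d1 ψ 1) + 2 * (-d1 φ 1) * ψ 0 / (-d1 ψ 1),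
    by positivity, fun x hx => ?_⟩
  have hxI : x ∈ Icc (0 : ℝ) 1 := ⟨hx.1.le, hx.2.le⟩
  have h1 := h.le_d1_φ hx
  have h2 := h.d1_φ_le hL hx
  have h3 := h.d1_ψ_nonpos hx
  have h4 := h.neg_le_x_mul_d1_ψ hx
  have h5 := h.φ_nonneg hxI
  have h6 := h.ψ_pos ⟨hx.1.le, hx.2⟩
  have h7 := h.le_ψ hxI
  have h8 := h.φ_le hxI
  have h9 := h.φ_le_of_tendsto hL ⟨hx.1, hx.2.le⟩
  have h10 : φ x * d1 ψ x / ψ x ≤ 0 :=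
    div_nonpos_of_nonpos_of_nonneg (mul_nonpos_of_nonneg_of_nonpos h5 h3) h6.le
  have h11 : -(φ x * d1 ψ x / ψ x) ≤
      2 * L * ψ 0 / (-d1 ψ 1) + 2 * (-d1 φ 1) * ψ 0 / (-d1 ψ 1) := by
    rw [← neg_div, div_le_iff₀ h6]
    rcases le_total x (1 / 2) with hx2 | hx2
    · have e1 : -(φ x * d1 ψ x) ≤ L * ψ 0 := by nlinarith
      have e2 : L * ψ 0 ≤ 2 * L * ψ 0 / (-d1 ψ 1) * ψ x := by
        rw [div_mul_eq_mul_div, le_div_iff₀ hb]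
        have : -d1 ψ 1 ≤ 2 * ψ x := by nlinarith
        have : 0 ≤ L * ψ 0 := by positivity
        nlinarith
      nlinarith [mul_nonneg hB h6.le]
    · have e0 : -d1 ψ x ≤ 2 * ψ 0 := by nlinarith
      have e1 : -(φ x * d1 ψ x) ≤ φ x * (2 * ψ 0) := by nlinarith
      have e2 : φ x * (2 * ψ 0) ≤ 2 * (-d1 φ 1) * ψ 0 / (-d1 ψ 1) * ψ x := by
        rw [div_mul_eq_mul_div, le_div_iff₀ hb]
        have : φ x * (-d1 ψ 1) ≤ (-d1 φ 1) * ψ x := by nlinarith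
        nlinarith
      nlinarith [mul_nonneg hA h6.le]
  rw [abs_le]
  constructor <;> linarith

/-- Second order expansion of `ψ` at `1`, with a remainder that is uniform on `[0, 1]`. -/
theorem exists_ψ_le_quadratic :
    ∃ M : ℝ, 0 ≤ M ∧ ∀ x ∈ Icc (0 : ℝ) 1, ψ x ≤ -d1 ψ 1 * (1 - x) + M * (1 - x) ^ 2 := by
  have hψ0 := h.ψ_zero_pos
  have hb := h.b_pos
  have hU : UniqueDiffOn ℝ (Ioc (0 : ℝ) 1) := uniqueDiffOn_Ioc 0 1
  have hc1 : ContDiffOn ℝ 1 (d1 ψ) (Ioc 0 1) :=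
    h.ψ_contDiffOn.derivWithin hU (by norm_num)
  have hsub : Icc (1 / 2 : ℝ) 1 ⊆ Ioc 0 1 := fun x hx => ⟨by linarith [hx.1], hx.2⟩
  have hcd : ContinuousOn (derivWithin (d1 ψ) (Ioc 0 1)) (Icc (1 / 2) 1) :=
    (hc1.continuousOn_derivWithin hU le_rfl).mono hsub
  obtain ⟨N, hN⟩ := (isCompact_Icc.image_of_continuousOn hcd.norm).bddAbove
  have hN' : ∀ x ∈ Icc (1 / 2 : ℝ) 1, ‖derivWithin (d1 ψ) (Ioc 0 1) x‖ ≤ N := fun x hx =>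
    hN ⟨x, hx, rfl⟩
  have hN0 : 0 ≤ N := (norm_nonneg _).trans (hN' 1 (by norm_num))
  have hlip : ∀ x ∈ Icc (1 / 2 : ℝ) 1, ‖d1 ψ x - d1 ψ 1‖ ≤ N * ‖x - 1‖ := fun x hx =>
    (convex_Icc (1 / 2 : ℝ) 1).norm_image_sub_le_of_norm_hasDerivWithin_le
      (fun z hz => ((hc1.differentiableOn one_ne_zero z (hsub hz)).hasDerivWithinAt).mono hsub)
      hN' (by norm_num) hx
  refine ⟨N + 4 * ψ 0, by positivity, fun x hx => ?_⟩
  rcases le_total x (1 / 2) with hx2 | hx2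
  · have h1 := h.ψ_le hx
    have h2 : ψ 0 * (1 - x) ≤ 4 * ψ 0 * (1 - x) ^ 2 := by
      have : (1 - x) ≤ 4 * (1 - x) ^ 2 := by nlinarith [hx.1]
      nlinarith
    have h3 : 0 ≤ -d1 ψ 1 * (1 - x) := mul_nonneg hb.le (by linarith [hx.2])
    nlinarith [mul_nonneg hN0 (sq_nonneg (1 - x))]
  · have key : ‖(ψ x - d1 ψ 1 * x) - (ψ 1 - d1 ψ 1 * 1)‖ ≤ (N * (1 - x)) * ‖x - 1‖ := by
      refine (convex_Icc x 1).norm_image_sub_le_of_norm_hasDerivWithin_le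
        (f := fun z => ψ z - d1 ψ 1 * z) (f' := fun z => d1 ψ z - d1 ψ 1) ?_ ?_
        (right_mem_Icc.2 hx.2) (left_mem_Icc.2 hx.2)
      · intro z hz
        have hz' : z ∈ Ioc (0 : ℝ) 1 := ⟨by linarith [hz.1], hz.2⟩
        have hs : Icc x 1 ⊆ Ioc 0 1 := fun u hu => ⟨by linarith [hu.1], hu.2⟩
        have h1 := (hasDerivWithinAt_d1 h.ψ_contDiffOn hz').mono hs
        exact (h1.fun_sub ((hasDerivWithinAt_id z _).const_mul (d1 ψ 1))).congr_deriv (by ring)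
      · intro z hz
        refine (hlip z ⟨hx2.trans hz.1, hz.2⟩).trans ?_
        rw [Real.norm_eq_abs, abs_of_nonpos (by linarith [hz.2])]
        have := hz.1
        gcongr
        linarith
    rw [Real.norm_eq_abs, Real.norm_eq_abs, h.ψ_one, abs_of_nonpos (by linarith [hx.2] : x - 1 ≤ 0)]
      at key
    have := (abs_le.1 key).2
    nlinarith [sq_nonneg (1 - x)]

end IsCoefficientPair

end Coefficients

/-! ### The logarithmic coordinate -/

/-- The coordinate `y = ∫_0^x b / ψ` on `(-∞, 1)`, with `b = -ψ'(1)`. To the left of `0` the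
coefficient `ψ` is continued by the constant `ψ 0`, so that the coordinate is a `C¹` bijection of
`(-∞, 1)` onto `ℝ`. -/
noncomputable def logCoord (ψ : ℝ → ℝ) (x : ℝ) : ℝ := ∫ y in (0 : ℝ)..x, -d1 ψ 1 / ψ (max y 0)

/-- The coordinate `p = exp y`, in which `ψ` becomes a linear vector field. -/
noncomputable def expCoord (ψ : ℝ → ℝ) (x : ℝ) : ℝ := Real.exp (logCoord ψ x)

/-- The inverse of `logCoord` on `(-∞, 1)`. -/
noncomputable def logCoordInv (ψ : ℝ → ℝ) : ℝ → ℝ := Function.invFunOn (logCoord ψ) (Iio 1)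

/-- The `φ`-part of the velocity field in the logarithmic coordinate: a characteristic satisfies
`dy/ds = speed y - b κ(s)`. -/
noncomputable def speed (φ ψ : ℝ → ℝ) (y : ℝ) : ℝ :=
  -d1 ψ 1 * φ (max (logCoordInv ψ y) 0) / ψ (max (logCoordInv ψ y) 0)

@[simp] theorem logCoord_zero (ψ : ℝ → ℝ) : logCoord ψ 0 = 0 := by simp [logCoord]

@[simp] theorem expCoord_zero (ψ : ℝ → ℝ) : expCoord ψ 0 = 1 := by simp [expCoord]

theorem max_zero_mem {x : ℝ} (hx : x < 1) : max x 0 ∈ Ico (0 : ℝ) 1 :=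
  ⟨le_max_right _ _, max_lt hx one_pos⟩

theorem continuousOn_max {f : ℝ → ℝ} (hf : ContinuousOn f (Icc 0 1)) :
    ContinuousOn (fun x => f (max x 0)) (Iio 1) :=
  hf.comp (by fun_prop) fun x hx => ⟨le_max_right _ _, max_le (le_of_lt hx) zero_le_one⟩

theorem expCoord_pos (ψ : ℝ → ℝ) (x : ℝ) : 0 < expCoord ψ x := Real.exp_pos _

namespace IsCoefficientPair

variable {φ ψ : ℝ → ℝ} (h : IsCoefficientPair φ ψ)
include h

theorem ψ_max_pos {x : ℝ} (hx : x < 1) : 0 < ψ (max x 0) := h.ψ_pos (max_zero_mem hx)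

theorem hasDerivAt_logCoord {x : ℝ} (hx : x < 1) :
    HasDerivAt (logCoord ψ) (-d1 ψ 1 / ψ (max x 0)) x := by
  have hc : ContinuousOn (fun y => -d1 ψ 1 / ψ (max y 0)) (Iio 1) :=
    continuousOn_const.div (continuousOn_max h.ψ_continuousOn) fun y hy => (h.ψ_max_pos hy).ne'
  refine intervalIntegral.integral_hasDerivAt_right ?_ ?_ (hc.continuousAt (Iio_mem_nhds hx))
  · refine (hc.mono fun y hy => ?_).intervalIntegrable
    exact lt_of_le_of_lt hy.2 (max_lt one_pos hx)
  · exact hc.stronglyMeasurableAtFilter isOpen_Iio x hx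

theorem continuousOn_logCoord : ContinuousOn (logCoord ψ) (Iio 1) := fun _ hx =>
  (h.hasDerivAt_logCoord hx).continuousAt.continuousWithinAt

theorem strictMonoOn_logCoord : StrictMonoOn (logCoord ψ) (Iio 1) := by
  refine strictMonoOn_of_deriv_pos (convex_Iio 1) h.continuousOn_logCoord fun x hx => ?_
  rw [interior_Iio] at hx
  rw [(h.hasDerivAt_logCoord hx).deriv]
  exact div_pos h.b_pos (h.ψ_max_pos hx)

theorem logCoord_le {x : ℝ} (hx : x ∈ Ico (0 : ℝ) 1) : logCoord ψ x ≤ -Real.log (1 - x) := by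
  have hd : ∀ z ∈ Ico (0 : ℝ) 1, HasDerivAt (fun z => logCoord ψ z + Real.log (1 - z))
      (-d1 ψ 1 / ψ (max z 0) + (-1) / (1 - z)) z := fun z hz =>
    (h.hasDerivAt_logCoord hz.2).add
      (((hasDerivAt_id z).const_sub 1).log (sub_ne_zero.2 hz.2.ne'))
  have hanti : AntitoneOn (fun z => logCoord ψ z + Real.log (1 - z)) (Ico 0 1) := by
    refine antitoneOn_of_deriv_nonpos (convex_Ico 0 1)
      (fun z hz => (hd z hz).continuousAt.continuousWithinAt)
      (fun z hz => (hd z (interior_subset hz)).differentiableAt.differentiableWithinAt) ?_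
    intro z hz
    rw [(hd z (interior_subset hz)).deriv]
    have hz' := interior_subset hz
    rw [max_eq_left hz'.1, neg_div (1 - z) 1, ← sub_eq_add_neg, sub_nonpos,
      div_le_div_iff₀ (h.ψ_pos hz') (by linarith [hz'.2])]
    simpa using h.le_ψ ⟨hz'.1, hz'.2.le⟩
  have := hanti (left_mem_Ico.2 one_pos) hx hx.1
  simp only [logCoord_zero, sub_zero, Real.log_one, add_zero] at this
  linarith

/-- The quadratic upper bound for `ψ` makes `logCoord ψ x + log (1 - x)` bounded below; this is where
`C²` regularity at `1` enters. -/
theorem exists_le_logCoord :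
    ∃ N : ℝ, 0 ≤ N ∧ ∀ x ∈ Ico (0 : ℝ) 1, -Real.log (1 - x) - N ≤ logCoord ψ x := by
  obtain ⟨M, hM0, hM⟩ := h.exists_ψ_le_quadratic
  have hb := h.b_pos
  refine ⟨M / (-d1 ψ 1), by positivity, fun x hx => ?_⟩
  have hd : ∀ z ∈ Ico (0 : ℝ) 1,
      HasDerivAt (fun z => logCoord ψ z + Real.log (1 - z) + M / (-d1 ψ 1) * z)
      (-d1 ψ 1 / ψ (max z 0) + (-1) / (1 - z) + M / (-d1 ψ 1) * 1) z := fun z hz =>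
    ((h.hasDerivAt_logCoord hz.2).add
      (((hasDerivAt_id z).const_sub 1).log (sub_ne_zero.2 hz.2.ne'))).add
      ((hasDerivAt_id z).const_mul _)
  have hmono : MonotoneOn (fun z => logCoord ψ z + Real.log (1 - z) + M / (-d1 ψ 1) * z)
      (Ico 0 1) := by
    refine monotoneOn_of_deriv_nonneg (convex_Ico 0 1)
      (fun z hz => (hd z hz).continuousAt.continuousWithinAt)
      (fun z hz => (hd z (interior_subset hz)).differentiableAt.differentiableWithinAt) ?_
    intro z hz
    rw [(hd z (interior_subset hz)).deriv]
    have hz' := interior_subset hz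
    have hu : 0 < 1 - z := by linarith [hz'.2]
    have h1 := hM z ⟨hz'.1, hz'.2.le⟩
    have h2 := h.ψ_pos hz'
    rw [max_eq_left hz'.1]
    set b := -d1 ψ 1
    have h3 : b / (b * (1 - z) + M * (1 - z) ^ 2) ≤ b / ψ z := by gcongr
    have h4 : 1 / (1 - z) - M / b ≤ b / (b * (1 - z) + M * (1 - z) ^ 2) := by
      rw [div_sub_div _ _ hu.ne' hb.ne', div_le_div_iff₀ (by positivity) (by positivity)]
      have : 0 ≤ M ^ 2 * (1 - z) ^ 3 := by positivity
      nlinarith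
    have h5 : (-1) / (1 - z) = -(1 / (1 - z)) := by ring
    linarith
  have := hmono (left_mem_Ico.2 one_pos) hx hx.1
  simp only [logCoord_zero, sub_zero, Real.log_one, add_zero, mul_zero] at this
  have h6 : M / (-d1 ψ 1) * x ≤ M / (-d1 ψ 1) :=
    mul_le_of_le_one_right (by positivity) hx.2.le
  linarith

theorem expCoord_le {x : ℝ} (hx : x ∈ Ico (0 : ℝ) 1) : expCoord ψ x ≤ 1 / (1 - x) := by
  rw [expCoord, one_div, ← Real.exp_log (inv_pos.2 (sub_pos.2 hx.2)), Real.log_inv]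
  exact Real.exp_le_exp.2 (h.logCoord_le hx)

theorem exists_le_expCoord :
    ∃ c : ℝ, 0 < c ∧ c ≤ 1 ∧ ∀ x ∈ Ico (0 : ℝ) 1, c / (1 - x) ≤ expCoord ψ x := by
  obtain ⟨N, hN0, hN⟩ := h.exists_le_logCoord
  refine ⟨Real.exp (-N), Real.exp_pos _, Real.exp_le_one_iff.2 (by linarith), fun x hx => ?_⟩
  have h1 : Real.exp (-N) / (1 - x) = Real.exp (-Real.log (1 - x) - N) := by
    rw [show -Real.log (1 - x) - N = -N + -Real.log (1 - x) by ring, Real.exp_add, Real.exp_neg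
      (Real.log _), Real.exp_log (sub_pos.2 hx.2), div_eq_mul_inv]
  rw [h1, expCoord]
  exact Real.exp_le_exp.2 (hN x hx)

theorem strictMonoOn_expCoord : StrictMonoOn (expCoord ψ) (Iio 1) := fun _ hx _ hy hxy =>
  Real.exp_lt_exp.2 (h.strictMonoOn_logCoord hx hy hxy)

theorem hasDerivAt_expCoord {x : ℝ} (hx : x ∈ Ico (0 : ℝ) 1) :
    HasDerivAt (expCoord ψ) (expCoord ψ x * (-d1 ψ 1 / ψ x)) x := by
  have := (h.hasDerivAt_logCoord hx.2).exp
  rwa [max_eq_left hx.1] at this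

theorem expCoord_sub_le {x y : ℝ} (hx : 0 ≤ x) (hxy : x ≤ y) (hy : y < 1) :
    expCoord ψ y - expCoord ψ x ≤ 1 / (1 - y) ^ 2 * (y - x) := by
  have hsub : Icc x y ⊆ Ico 0 1 := fun z hz => ⟨hx.trans hz.1, hz.2.trans_lt hy⟩
  refine (convex_Icc x y).image_sub_le_mul_sub_of_deriv_le
    (fun z hz => (h.hasDerivAt_expCoord (hsub hz)).continuousAt.continuousWithinAt)
    (fun z hz => (h.hasDerivAt_expCoord
      (hsub (interior_subset hz))).differentiableAt.differentiableWithinAt) ?_ x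
    (left_mem_Icc.2 hxy) y (right_mem_Icc.2 hxy) hxy
  intro z hz
  have hz' := hsub (interior_subset hz)
  have hz2 := (interior_subset hz).2
  rw [(h.hasDerivAt_expCoord hz').deriv]
  have hu : 0 < 1 - z := by linarith [hz'.2]
  have huy : 0 < 1 - y := by linarith
  have h1 : -d1 ψ 1 / ψ z ≤ 1 / (1 - z) := by
    rw [div_le_div_iff₀ (h.ψ_pos hz') hu]
    simpa using h.le_ψ ⟨hz'.1, hz'.2.le⟩
  calc expCoord ψ z * (-d1 ψ 1 / ψ z) ≤ 1 / (1 - z) * (1 / (1 - z)) := by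
        gcongr
        · exact div_nonneg h.b_pos.le (h.ψ_pos hz').le
        · exact h.expCoord_le hz'
    _ = 1 / (1 - z) ^ 2 := by rw [div_mul_div_comm]; ring
    _ ≤ 1 / (1 - y) ^ 2 := by gcongr

theorem exists_le_expCoord_sub : ∃ c : ℝ, 0 < c ∧ ∀ x y, 0 ≤ x → x ≤ y → y < 1 →
    c / (1 - x) ^ 2 * (y - x) ≤ expCoord ψ y - expCoord ψ x := by
  obtain ⟨c, hc, -, hcE⟩ := h.exists_le_expCoord
  have hb := h.b_pos
  have hψ0 := h.ψ_zero_pos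
  refine ⟨c * (-d1 ψ 1 / ψ 0), by positivity, fun x y hx hxy hy => ?_⟩
  have hsub : Icc x y ⊆ Ico 0 1 := fun z hz => ⟨hx.trans hz.1, hz.2.trans_lt hy⟩
  refine (convex_Icc x y).mul_sub_le_image_sub_of_le_deriv
    (fun z hz => (h.hasDerivAt_expCoord (hsub hz)).continuousAt.continuousWithinAt)
    (fun z hz => (h.hasDerivAt_expCoord
      (hsub (interior_subset hz))).differentiableAt.differentiableWithinAt) ?_ x
    (left_mem_Icc.2 hxy) y (right_mem_Icc.2 hxy) hxy
  intro z hz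
  have hz' := hsub (interior_subset hz)
  have hz2 := (interior_subset hz).1
  rw [(h.hasDerivAt_expCoord hz').deriv]
  have hu : 0 < 1 - z := by linarith [hz'.2]
  have h1 : -d1 ψ 1 / (ψ 0 * (1 - z)) ≤ -d1 ψ 1 / ψ z := by
    have := h.ψ_le ⟨hz'.1, hz'.2.le⟩
    have := h.ψ_pos hz'
    gcongr
  calc c * (-d1 ψ 1 / ψ 0) / (1 - x) ^ 2 ≤ c * (-d1 ψ 1 / ψ 0) / (1 - z) ^ 2 := by gcongr
    _ = c / (1 - z) * (-d1 ψ 1 / (ψ 0 * (1 - z))) := by field_simp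
    _ ≤ expCoord ψ z * (-d1 ψ 1 / ψ z) := by
        gcongr
        · exact (expCoord_pos ψ z).le
        · exact hcE z hz'

theorem logCoord_surjOn : SurjOn (logCoord ψ) (Iio 1) univ := by
  obtain ⟨N, hN0, hN⟩ := h.exists_le_logCoord
  have hb := h.b_pos
  have hψ0 := h.ψ_zero_pos
  intro y _
  have hleft : ∃ x ≤ (0 : ℝ), logCoord ψ x ≤ y := by
    refine ⟨-(ψ 0 / (-d1 ψ 1) * |y|), by simp; positivity, ?_⟩
    have hx : -(ψ 0 / (-d1 ψ 1) * |y|) ≤ 0 := by simp; positivity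
    have h1 : logCoord ψ (-(ψ 0 / (-d1 ψ 1) * |y|)) =
        ∫ z in (0 : ℝ)..(-(ψ 0 / (-d1 ψ 1) * |y|)), -d1 ψ 1 / ψ 0 := by
      refine intervalIntegral.integral_congr fun z hz => ?_
      rw [uIcc_of_ge hx] at hz
      simp only [max_eq_right hz.2]
    rw [h1, intervalIntegral.integral_const, smul_eq_mul]
    have h2 : (-(ψ 0 / (-d1 ψ 1) * |y|) - 0) * (-d1 ψ 1 / ψ 0) = -|y| := by
      rw [sub_zero]
      generalize -d1 ψ 1 = b at hb
      field_simp
    rw [h2]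
    exact neg_abs_le y
  have hright : ∃ x ∈ Ico (0 : ℝ) 1, y ≤ logCoord ψ x := by
    have he : Real.exp (-(|y| + N)) ≤ 1 := Real.exp_le_one_iff.2 (by linarith [abs_nonneg y])
    have hm : 1 - Real.exp (-(|y| + N)) ∈ Ico (0 : ℝ) 1 :=
      ⟨by linarith, by linarith [Real.exp_pos (-(|y| + N))]⟩
    refine ⟨_, hm, le_trans ?_ (hN _ hm)⟩
    rw [sub_sub_cancel, Real.log_exp]
    linarith [le_abs_self y]
  obtain ⟨x₁, hx₁, h₁⟩ := hleft
  obtain ⟨x₂, hx₂, h₂⟩ := hright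
  obtain ⟨x, hx, hxy⟩ := intermediate_value_Icc (hx₁.trans hx₂.1)
    (h.continuousOn_logCoord.mono fun z hz => lt_of_le_of_lt hz.2 hx₂.2) ⟨h₁, h₂⟩
  exact ⟨x, lt_of_le_of_lt hx.2 hx₂.2, hxy⟩

theorem logCoordInv_lt (y : ℝ) : logCoordInv ψ y < 1 :=
  Function.invFunOn_mem (h.logCoord_surjOn (mem_univ y))

@[simp] theorem logCoord_logCoordInv (y : ℝ) : logCoord ψ (logCoordInv ψ y) = y :=
  Function.invFunOn_eq (h.logCoord_surjOn (mem_univ y))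

theorem logCoordInv_logCoord {x : ℝ} (hx : x < 1) : logCoordInv ψ (logCoord ψ x) = x :=
  h.strictMonoOn_logCoord.injOn (h.logCoordInv_lt _) hx (h.logCoord_logCoordInv _)

theorem strictMono_logCoordInv : StrictMono (logCoordInv ψ) := fun y z hyz => by
  rw [← h.strictMonoOn_logCoord.lt_iff_lt (h.logCoordInv_lt y) (h.logCoordInv_lt z)]
  simpa [h.logCoord_logCoordInv] using hyz

theorem logCoordInv_zero : logCoordInv ψ 0 = 0 := by
  simpa using h.logCoordInv_logCoord one_pos

theorem logCoordInv_nonneg {y : ℝ} (hy : 0 ≤ y) : 0 ≤ logCoordInv ψ y := by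
  rw [← h.logCoordInv_zero]
  exact h.strictMono_logCoordInv.monotone hy

theorem logCoord_nonneg {x : ℝ} (hx : x ∈ Ico (0 : ℝ) 1) : 0 ≤ logCoord ψ x := by
  rw [← logCoord_zero ψ]
  exact h.strictMonoOn_logCoord.monotoneOn (by simp) hx.2 hx.1

theorem continuous_logCoordInv : Continuous (logCoordInv ψ) := by
  rw [continuous_iff_continuousAt]
  intro y
  refine continuousAt_of_monotoneOn_of_image_mem_nhds
    (h.strictMono_logCoordInv.monotone.monotoneOn univ) univ_mem ?_
  refine mem_of_superset (Iio_mem_nhds (h.logCoordInv_lt y)) fun x hx => ?_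
  exact ⟨logCoord ψ x, mem_univ _, h.logCoordInv_logCoord hx⟩

theorem hasDerivAt_logCoordInv (y : ℝ) :
    HasDerivAt (logCoordInv ψ) (ψ (max (logCoordInv ψ y) 0) / (-d1 ψ 1)) y := by
  have hpos := h.ψ_max_pos (h.logCoordInv_lt y)
  have := HasDerivAt.of_local_left_inverse h.continuous_logCoordInv.continuousAt
    (h.hasDerivAt_logCoord (h.logCoordInv_lt y)) (div_pos h.b_pos hpos).ne'
    (Eventually.of_forall h.logCoord_logCoordInv)
  rwa [inv_div] at this

theorem speed_max (y : ℝ) : speed φ ψ (max y 0) = speed φ ψ y := by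
  rcases le_total y 0 with hy | hy
  · have h1 : logCoordInv ψ y ≤ 0 := by
      rw [← h.logCoordInv_zero]; exact h.strictMono_logCoordInv.monotone hy
    rw [max_eq_right hy, speed, speed, h.logCoordInv_zero, max_self, max_eq_right h1]
  · rw [max_eq_left hy]

theorem speed_nonneg (y : ℝ) : 0 ≤ speed φ ψ y := by
  have hm := max_zero_mem (h.logCoordInv_lt y)
  exact div_nonneg (mul_nonneg h.b_pos.le (h.φ_nonneg ⟨hm.1, hm.2.le⟩)) (h.ψ_pos hm).le

theorem speed_le (y : ℝ) : speed φ ψ y ≤ -d1 φ 1 := by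
  have hm := max_zero_mem (h.logCoordInv_lt y)
  rw [speed, div_le_iff₀ (h.ψ_pos hm)]
  have h1 := h.φ_le ⟨hm.1, hm.2.le⟩
  have h2 := h.le_ψ ⟨hm.1, hm.2.le⟩
  have ha : 0 < -d1 φ 1 := by linarith [h.φ_slope_neg]
  have hb := h.b_pos
  nlinarith

theorem speed_of_nonpos {y : ℝ} (hy : y ≤ 0) : speed φ ψ y = 0 := by
  rw [← h.speed_max, max_eq_right hy, speed, h.logCoordInv_zero, max_self, h.φ_zero]
  simp

theorem continuous_speed : Continuous (speed φ ψ) := by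
  have h1 : ∀ {f : ℝ → ℝ}, ContinuousOn f (Icc 0 1) →
      Continuous fun y => f (max (logCoordInv ψ y) 0) := fun hf => by
    rw [← continuousOn_univ]
    exact (continuousOn_max hf).comp h.continuous_logCoordInv.continuousOn
      fun y _ => h.logCoordInv_lt y
  exact (continuous_const.mul (h1 h.φ_continuousOn)).div (h1 h.ψ_continuousOn)
    fun y => (h.ψ_max_pos (h.logCoordInv_lt y)).ne'

theorem logCoordInv_mem_Ioo {y : ℝ} (hy : 0 < y) : logCoordInv ψ y ∈ Ioo (0 : ℝ) 1 :=
  ⟨by rw [← h.logCoordInv_zero]; exact h.strictMono_logCoordInv hy, h.logCoordInv_lt y⟩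

theorem hasDerivAt_speed {y : ℝ} (hy : 0 < y) :
    HasDerivAt (speed φ ψ) (d1 φ (logCoordInv ψ y) -
      φ (logCoordInv ψ y) * d1 ψ (logCoordInv ψ y) / ψ (logCoordInv ψ y)) y := by
  have hx := h.logCoordInv_mem_Ioo hy
  have hψ := h.ψ_pos ⟨hx.1.le, hx.2⟩
  have h0 := h.hasDerivAt_logCoordInv y
  rw [max_eq_left hx.1.le] at h0
  have h1 := (hasDerivAt_d1 h.φ_contDiffOn hx).comp y h0
  have h2 := (hasDerivAt_d1 h.ψ_contDiffOn hx).comp y h0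
  have h3 := (h1.const_mul (-d1 ψ 1)).div h2 hψ.ne'
  have hev : speed φ ψ =ᶠ[𝓝 y] fun z =>
      -d1 ψ 1 * φ (logCoordInv ψ z) / ψ (logCoordInv ψ z) := by
    filter_upwards [lt_mem_nhds hy] with z hz
    rw [speed, max_eq_left (h.logCoordInv_mem_Ioo hz).1.le]
  refine (h3.congr_of_eventuallyEq hev).congr_deriv ?_
  have hb := h.b_pos.ne'
  simp only [Function.comp]
  generalize -d1 ψ 1 = b at hb
  field_simp

theorem exists_lipschitz_speed (hφ0 : ∃ L : ℝ, Tendsto (fun x => φ x / x) (𝓝[>] 0) (𝓝 L)) :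
    ∃ K : NNReal, LipschitzWith K (speed φ ψ) := by
  obtain ⟨K, hK0, hK⟩ := h.exists_bound_wronskian hφ0
  refine ⟨⟨K, hK0⟩, ?_⟩
  have key : ∀ y z : ℝ, 0 ≤ y → y ≤ z → |speed φ ψ z - speed φ ψ y| ≤ K * (z - y) := by
    intro y z hy hyz
    rcases hyz.eq_or_lt with rfl | hlt
    · simp
    obtain ⟨c, hc, hcs⟩ := exists_hasDerivAt_eq_slope (speed φ ψ) _ hlt
      h.continuous_speed.continuousOn fun c hc => h.hasDerivAt_speed (hy.trans_lt hc.1)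
    rw [eq_div_iff (sub_pos.2 hlt).ne'] at hcs
    rw [← hcs, abs_mul, abs_of_pos (sub_pos.2 hlt)]
    gcongr
    exact hK _ (h.logCoordInv_mem_Ioo (hy.trans_lt hc.1))
  have key2 : ∀ y z : ℝ, 0 ≤ y → 0 ≤ z → |speed φ ψ y - speed φ ψ z| ≤ K * |y - z| := by
    intro y z hy hz
    rcases le_total y z with hyz | hyz
    · rw [abs_sub_comm, abs_sub_comm y, abs_of_nonneg (sub_nonneg.2 hyz)]
      exact key y z hy hyz
    · rw [abs_of_nonneg (sub_nonneg.2 hyz)]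
      exact key z y hz hyz
  refine LipschitzWith.of_dist_le_mul fun y z => ?_
  rw [Real.dist_eq, Real.dist_eq, ← h.speed_max y, ← h.speed_max z]
  refine (key2 _ _ (le_max_right _ _) (le_max_right _ _)).trans ?_
  exact mul_le_mul_of_nonneg_left (abs_max_sub_max_le_abs _ _ _) hK0

/-- In the coordinate `p = exp y` the `φ`-part of the velocity is `p * speed (log p)`. Its
derivative is `Γ - φ'(1)`, so that monotonicity of `Γ` is exactly concavity of this field. -/
theorem concaveOn_expSpeed (hΓ : AntitoneOn (Gam φ ψ) (Ioo 0 1)) :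
    ConcaveOn ℝ (Ici 1) fun p => p * speed φ ψ (Real.log p) := by
  have hd : ∀ p ∈ Ioi (1 : ℝ), HasDerivAt (fun p => p * speed φ ψ (Real.log p))
      (Gam φ ψ (logCoordInv ψ (Real.log p)) - d1 φ 1) p := by
    intro p hp
    have hp0 : 0 < p := one_pos.trans hp
    have hx := h.logCoordInv_mem_Ioo (Real.log_pos hp)
    have hψ := h.ψ_pos ⟨hx.1.le, hx.2⟩
    have h1 := (hasDerivAt_id p).mul
      ((h.hasDerivAt_speed (Real.log_pos hp)).comp p (Real.hasDerivAt_log hp0.ne'))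
    refine h1.congr_deriv ?_
    simp only [id, Function.comp, one_mul, Gam, speed, max_eq_left hx.1.le]
    field_simp
    ring
  refine AntitoneOn.concaveOn_of_deriv (convex_Ici 1) ?_ ?_ ?_
  · refine continuousOn_id.mul (h.continuous_speed.comp_continuousOn ?_)
    exact Real.continuousOn_log.mono fun p (hp : 1 ≤ p) => (one_pos.trans_le hp).ne'
  · rw [interior_Ici]
    exact fun p hp => (hd p hp).differentiableAt.differentiableWithinAt
  · rw [interior_Ici]
    intro p hp q hq hpq
    rw [(hd p hp).deriv, (hd q hq).deriv]
    have := hΓ (h.logCoordInv_mem_Ioo (Real.log_pos hp)) (h.logCoordInv_mem_Ioo (Real.log_pos hq))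
      (h.strictMono_logCoordInv.monotone (Real.log_le_log (one_pos.trans hp) hpq))
    linarith

/-- A concave function that is bounded below on a half-line is nondecreasing. -/
theorem monotoneOn_expSpeed (hΓ : AntitoneOn (Gam φ ψ) (Ioo 0 1)) :
    MonotoneOn (fun p => p * speed φ ψ (Real.log p)) (Ici 1) := by
  set Φ := fun p => p * speed φ ψ (Real.log p) with hΦ
  have hc : ConcaveOn ℝ (Ici 1) Φ := h.concaveOn_expSpeed hΓ
  have hnn : ∀ p ∈ Ici (1 : ℝ), 0 ≤ Φ p := fun p hp =>
    mul_nonneg (zero_le_one.trans hp) (h.speed_nonneg _)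
  intro p hp q hq hpq
  by_contra! hlt
  have hpq' : p < q := lt_of_le_of_ne hpq fun e => by simp [e] at hlt
  -- the chord through `p` and `q`, extended to the right, becomes negative at `r`
  set s := (Φ p - Φ q) / (q - p) with hs
  have hs0 : 0 < s := div_pos (sub_pos.2 hlt) (sub_pos.2 hpq')
  set r := q + (Φ q + 1) / s with hr
  have hqr : q < r := by
    have : 0 < (Φ q + 1) / s := div_pos (by linarith [hnn q hq]) hs0
    linarith
  have h1 := hc.slope_anti_adjacent hp (mem_Ici.2 (hq.trans hqr.le)) hpq' hqr
  rw [div_le_iff₀ (sub_pos.2 hqr)] at h1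
  have h2 : (Φ q - Φ p) / (q - p) = -s := by rw [hs, ← neg_div, neg_sub]
  have h3 : s * (r - q) = Φ q + 1 := by rw [hr]; field_simp; ring
  have := hnn r (hq.trans hqr.le)
  rw [h2] at h1
  linarith

end IsCoefficientPair

/-! ### Comparison of scalar differential inequalities -/

theorem monotoneOn_of_hasDerivWithinAt_Icc {f f' : ℝ → ℝ} {a b : ℝ}
    (hf : ∀ r ∈ Icc a b, HasDerivWithinAt f (f' r) (Icc a b) r) (h0 : ∀ r ∈ Icc a b, 0 ≤ f' r) :
    MonotoneOn f (Icc a b) :=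
  monotoneOn_of_hasDerivWithinAt_nonneg (convex_Icc a b)
    (fun r hr => (hf r hr).continuousWithinAt)
    (fun r hr => (hf r (interior_subset hr)).mono interior_subset)
    fun r hr => h0 r (interior_subset hr)

/-- A function that is negative at time `a` and satisfies `D' ≤ -K D` while it is negative remains
negative. -/
theorem neg_of_hasDerivWithinAt_le {D D' : ℝ → ℝ} {a b K : ℝ} (hab : a ≤ b)
    (hD : ∀ r ∈ Icc a b, HasDerivWithinAt D (D' r) (Icc a b) r)
    (hle : ∀ r ∈ Icc a b, D r < 0 → D' r ≤ -K * D r) (ha : D a < 0) : D b < 0 := by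
  set g : ℝ → ℝ := fun r => D r * Real.exp (K * r) with hg
  have hexp : ∀ r, HasDerivAt (fun r => Real.exp (K * r)) (Real.exp (K * r) * (K * 1)) r :=
    fun r => ((hasDerivAt_id r).const_mul K).exp
  have hgd : ∀ r ∈ Icc a b, HasDerivWithinAt g
      (D' r * Real.exp (K * r) + D r * (Real.exp (K * r) * (K * 1))) (Icc a b) r := fun r hr =>
    (hD r hr).mul (hexp r).hasDerivWithinAt
  have hga : g a < 0 := mul_neg_of_neg_of_pos ha (Real.exp_pos _)
  -- a barrier that increases strictly but stays negative on `[a, b]`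
  set q : ℝ := -g a / (2 * (b - a) + 1) with hq
  have hden : 0 < 2 * (b - a) + 1 := by linarith
  have hq0 : 0 < q := div_pos (neg_pos.2 hga) hden
  have hqd : q * (2 * (b - a) + 1) = -g a := div_mul_cancel₀ _ hden.ne'
  have hneg : ∀ r ∈ Icc a b, g a + q * (r - a) < 0 := fun r hr => by nlinarith [hr.1, hr.2]
  have key : g b ≤ g a + q * (b - a) := by
    refine image_le_of_deriv_right_lt_deriv_boundary' (B := fun r => g a + q * (r - a))
      (B' := fun _ => q) (fun r hr => (hgd r hr).continuousWithinAt)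
      (fun r hr => ((hgd r ⟨hr.1, hr.2.le⟩).mono_of_mem_nhdsWithin
        (Icc_mem_nhdsGE_of_mem hr))) (by simp) (by fun_prop)
      (fun r _ => ?_) ?_ (right_mem_Icc.2 hab)
    · simpa using ((((hasDerivAt_id r).sub_const a).const_mul q).const_add (g a)).hasDerivWithinAt
    · intro r hr hrB
      have hr' : r ∈ Icc a b := ⟨hr.1, hr.2.le⟩
      have h1 : g r < 0 := hrB ▸ hneg r hr'
      have h2 : D r < 0 := neg_of_mul_neg_left h1 (Real.exp_pos _).le
      have h3 := hle r hr' h2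
      have h4 : (D' r + K * D r) * Real.exp (K * r) ≤ 0 :=
        mul_nonpos_of_nonpos_of_nonneg (by linarith) (Real.exp_pos _).le
      linarith
  exact neg_of_mul_neg_left (key.trans_lt (hneg b (right_mem_Icc.2 hab))) (Real.exp_pos _).le

/-! ### Characteristics in the logarithmic coordinate -/

/-- A characteristic written in the coordinate `logCoord ψ`. -/
def IsLogChar (φ ψ κ : ℝ → ℝ) (a b : ℝ) (η : ℝ → ℝ) : Prop :=
  ∀ r ∈ Icc a b, HasDerivWithinAt η (speed φ ψ (η r) - -d1 ψ 1 * κ r) (Icc a b) r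

/-- The integral `∫_0^r κ` (`κ` is continued by `κ 0` to negative times). -/
noncomputable def cumul (κ : ℝ → ℝ) (r : ℝ) : ℝ := ∫ ρ in (0 : ℝ)..r, κ (max ρ 0)

theorem continuous_max_zero {κ : ℝ → ℝ} (hκ : ContinuousOn κ (Ici 0)) :
    Continuous fun r => κ (max r 0) := by
  rw [← continuousOn_univ]
  exact hκ.comp (by fun_prop) fun r _ => mem_Ici.2 (le_max_right _ _)

theorem hasDerivAt_cumul {κ : ℝ → ℝ} (hκ : ContinuousOn κ (Ici 0)) (r : ℝ) :
    HasDerivAt (cumul κ) (κ (max r 0)) r := by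
  have hc := continuous_max_zero hκ
  exact intervalIntegral.integral_hasDerivAt_right (hc.intervalIntegrable _ _)
    (hc.stronglyMeasurableAtFilter _ _) hc.continuousAt

theorem strictMono_cumul {κ : ℝ → ℝ} (hκ : ContinuousOn κ (Ici 0)) (hpos : ∀ t, 0 ≤ t → 0 < κ t) :
    StrictMono (cumul κ) := by
  refine strictMono_of_deriv_pos fun r => ?_
  rw [(hasDerivAt_cumul hκ r).deriv]
  exact hpos _ (le_max_right _ _)

namespace IsLogChar

variable {φ ψ κ : ℝ → ℝ} {a b : ℝ} {η η₁ η₂ η₃ : ℝ → ℝ}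

theorem mono (hη : IsLogChar φ ψ κ a b η) {a' b' : ℝ} (ha : a ≤ a') (hb : b' ≤ b) :
    IsLogChar φ ψ κ a' b' η := fun r hr =>
  (hη r ⟨ha.trans hr.1, hr.2.trans hb⟩).mono (Icc_subset_Icc ha hb)

theorem nonneg (h : IsCoefficientPair φ ψ) (hκ : ∀ t ∈ Icc a b, 0 < κ t)
    (hη : IsLogChar φ ψ κ a b η) (hb : 0 ≤ η b) : ∀ r ∈ Icc a b, 0 ≤ η r := by
  intro r hr
  by_contra! hlt
  refine absurd (neg_of_hasDerivWithinAt_le (K := 0) hr.2 (hη.mono hr.1 le_rfl) ?_ hlt) hb.not_gt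
  intro q hq hlt'
  rw [h.speed_of_nonpos hlt'.le]
  have := mul_pos h.b_pos (hκ q ⟨hr.1.trans hq.1, hq.2⟩)
  linarith

/-- Characteristics do not cross. -/
theorem le_of_le {K : NNReal} (hK : LipschitzWith K (speed φ ψ))
    (h₁ : IsLogChar φ ψ κ a b η₁) (h₂ : IsLogChar φ ψ κ a b η₂) (hb : η₁ b ≤ η₂ b) :
    ∀ r ∈ Icc a b, η₁ r ≤ η₂ r := by
  intro r hr
  by_contra! hlt
  have := neg_of_hasDerivWithinAt_le (K := K) hr.2
    (fun q hq => ((h₂.mono hr.1 le_rfl) q hq).sub ((h₁.mono hr.1 le_rfl) q hq)) ?_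
    (by simpa using sub_neg.2 hlt)
  · simp only [Pi.sub_apply] at this
    linarith
  · intro q _ hq
    simp only [Pi.sub_apply] at hq ⊢
    have := hK.dist_le_mul (η₂ q) (η₁ q)
    rw [Real.dist_eq, Real.dist_eq, abs_of_neg hq] at this
    linarith [le_abs_self (speed φ ψ (η₂ q) - speed φ ψ (η₁ q))]

theorem eqOn {K : NNReal} (hK : LipschitzWith K (speed φ ψ))
    (h₁ : IsLogChar φ ψ κ a b η₁) (h₂ : IsLogChar φ ψ κ a b η₂) (hb : η₁ b = η₂ b) :
    EqOn η₁ η₂ (Icc a b) := fun r hr =>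
  le_antisymm (h₁.le_of_le hK h₂ hb.le r hr) (h₂.le_of_le hK h₁ hb.ge r hr)

theorem sub_le_exp_mul {K : NNReal} (hK : LipschitzWith K (speed φ ψ))
    (h₁ : IsLogChar φ ψ κ a b η₁) (h₂ : IsLogChar φ ψ κ a b η₂) (hb : η₁ b ≤ η₂ b)
    (hab : a ≤ b) : η₂ a - η₁ a ≤ Real.exp (K * (b - a)) * (η₂ b - η₁ b) := by
  have hexp : ∀ r, HasDerivAt (fun r : ℝ => Real.exp (K * r)) (Real.exp (K * r) * (K * 1)) r :=
    fun r => ((hasDerivAt_id r).const_mul (K : ℝ)).exp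
  have hm : MonotoneOn (fun r => (η₂ r - η₁ r) * Real.exp (K * r)) (Icc a b) := by
    refine monotoneOn_of_hasDerivWithinAt_Icc (fun r hr => ((h₂ r hr).sub (h₁ r hr)).mul
      (hexp r).hasDerivWithinAt) fun r hr => ?_
    have h0 := h₁.le_of_le hK h₂ hb r hr
    have := hK.dist_le_mul (η₂ r) (η₁ r)
    rw [Real.dist_eq, Real.dist_eq, abs_of_nonneg (sub_nonneg.2 h0)] at this
    have h1 := neg_abs_le (speed φ ψ (η₂ r) - speed φ ψ (η₁ r))
    have h2 : 0 ≤ (speed φ ψ (η₂ r) - speed φ ψ (η₁ r) + K * (η₂ r - η₁ r)) *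
      Real.exp (K * r) := mul_nonneg (by linarith) (Real.exp_pos _).le
    simp only [Pi.sub_apply]
    linarith
  have h3 := hm (left_mem_Icc.2 hab) (right_mem_Icc.2 hab) hab
  simp only at h3
  rw [mul_sub (K : ℝ), Real.exp_sub, div_mul_eq_mul_div, le_div_iff₀ (Real.exp_pos _)]
  linarith

/-- Concavity of the velocity field in the coordinate `p = exp y` makes the backward flow convex in
that coordinate; this is the three-point form of convexity. -/
theorem exp_convex (h : IsCoefficientPair φ ψ) (hΓ : AntitoneOn (Gam φ ψ) (Ioo 0 1))
    (hκc : ContinuousOn κ (Icc a b)) (hκ : ∀ t ∈ Icc a b, 0 < κ t) (hab : a ≤ b)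
    (h₁ : IsLogChar φ ψ κ a b η₁) (h₂ : IsLogChar φ ψ κ a b η₂) (h₃ : IsLogChar φ ψ κ a b η₃)
    (h0 : 0 ≤ η₁ b) (h12 : η₁ b ≤ η₂ b) (h23 : η₂ b < η₃ b) :
    (Real.exp (η₂ a) - Real.exp (η₁ a)) * (Real.exp (η₃ b) - Real.exp (η₁ b)) ≤
      (Real.exp (η₂ b) - Real.exp (η₁ b)) * (Real.exp (η₃ a) - Real.exp (η₁ a)) := by
  have hden : 0 < Real.exp (η₃ b) - Real.exp (η₁ b) :=
    sub_pos.2 (Real.exp_lt_exp.2 (h12.trans_lt h23))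
  set l : ℝ := (Real.exp (η₂ b) - Real.exp (η₁ b)) / (Real.exp (η₃ b) - Real.exp (η₁ b)) with hl
  have hl0 : 0 ≤ l := div_nonneg (sub_nonneg.2 (Real.exp_le_exp.2 h12)) hden.le
  have hl1 : l ≤ 1 := by
    rw [hl, div_le_one hden]
    linarith [Real.exp_le_exp.2 h23.le]
  have hlb : l * (Real.exp (η₃ b) - Real.exp (η₁ b)) = Real.exp (η₂ b) - Real.exp (η₁ b) :=
    div_mul_cancel₀ _ hden.ne'
  have hn₁ := h₁.nonneg h hκ h0
  have hn₂ := h₂.nonneg h hκ (h0.trans h12)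
  have hn₃ := h₃.nonneg h hκ (h0.trans (h12.trans h23.le))
  obtain ⟨N, hN⟩ := (isCompact_Icc.image_of_continuousOn hκc).bddAbove
  have hN' : ∀ r ∈ Icc a b, κ r ≤ N := fun r hr => hN ⟨r, hr, rfl⟩
  set Φ : ℝ → ℝ := fun p => p * speed φ ψ (Real.log p) with hΦ
  have hcc : ConcaveOn ℝ (Ici 1) Φ := h.concaveOn_expSpeed hΓ
  have hmm : MonotoneOn Φ (Ici 1) := h.monotoneOn_expSpeed hΓ
  set θ : ℝ → ℝ := fun r => (1 - l) * Real.exp (η₁ r) + l * Real.exp (η₃ r) with hθ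
  have hd : ∀ r ∈ Icc a b, HasDerivWithinAt (fun r => θ r - Real.exp (η₂ r))
      ((1 - l) * (Real.exp (η₁ r) * (speed φ ψ (η₁ r) - -d1 ψ 1 * κ r)) +
        l * (Real.exp (η₃ r) * (speed φ ψ (η₃ r) - -d1 ψ 1 * κ r)) -
        Real.exp (η₂ r) * (speed φ ψ (η₂ r) - -d1 ψ 1 * κ r)) (Icc a b) r := fun r hr =>
    (((h₁ r hr).exp.const_mul _).add ((h₃ r hr).exp.const_mul _)).sub (h₂ r hr).exp
  have hmain : 0 ≤ θ a - Real.exp (η₂ a) := by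
    by_contra! hlt
    have := neg_of_hasDerivWithinAt_le (K := -d1 ψ 1 * N) hab hd ?_ hlt
    · simp only [hθ] at this
      linarith
    intro r hr hneg
    have e₁ : Φ (Real.exp (η₁ r)) = Real.exp (η₁ r) * speed φ ψ (η₁ r) := by
      simp [hΦ, Real.log_exp]
    have e₂ : Φ (Real.exp (η₂ r)) = Real.exp (η₂ r) * speed φ ψ (η₂ r) := by
      simp [hΦ, Real.log_exp]
    have e₃ : Φ (Real.exp (η₃ r)) = Real.exp (η₃ r) * speed φ ψ (η₃ r) := by
      simp [hΦ, Real.log_exp]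
    have m₁ : Real.exp (η₁ r) ∈ Ici (1 : ℝ) := Real.one_le_exp (hn₁ r hr)
    have m₂ : Real.exp (η₂ r) ∈ Ici (1 : ℝ) := Real.one_le_exp (hn₂ r hr)
    have m₃ : Real.exp (η₃ r) ∈ Ici (1 : ℝ) := Real.one_le_exp (hn₃ r hr)
    have c1 : (1 - l) * Φ (Real.exp (η₁ r)) + l * Φ (Real.exp (η₃ r)) ≤ Φ (θ r) := by
      simpa [hθ] using hcc.2 m₁ m₃ (sub_nonneg.2 hl1) hl0 (by ring)
    have mθ : θ r ∈ Ici (1 : ℝ) := by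
      simpa [hθ] using hcc.1 m₁ m₃ (sub_nonneg.2 hl1) hl0 (by ring)
    have c2 : Φ (θ r) ≤ Φ (Real.exp (η₂ r)) := hmm mθ m₂ (by linarith)
    have c3 : 0 ≤ -d1 ψ 1 * (N - κ r) := mul_nonneg h.b_pos.le (by linarith [hN' r hr])
    rw [e₁, e₃] at c1
    rw [e₂] at c2
    have c4 : (1 - l) * (Real.exp (η₁ r) * (speed φ ψ (η₁ r) - -d1 ψ 1 * κ r)) +
        l * (Real.exp (η₃ r) * (speed φ ψ (η₃ r) - -d1 ψ 1 * κ r)) -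
        Real.exp (η₂ r) * (speed φ ψ (η₂ r) - -d1 ψ 1 * κ r) =
        (1 - l) * (Real.exp (η₁ r) * speed φ ψ (η₁ r)) +
        l * (Real.exp (η₃ r) * speed φ ψ (η₃ r)) - Real.exp (η₂ r) * speed φ ψ (η₂ r) -
        (-d1 ψ 1 * κ r) * (θ r - Real.exp (η₂ r)) := by
      simp only [hθ]; ring
    rw [c4]
    have c5 := mul_nonpos_of_nonneg_of_nonpos c3 hneg.le
    linarith
  have hfin : Real.exp (η₂ a) - Real.exp (η₁ a) ≤ l * (Real.exp (η₃ a) - Real.exp (η₁ a)) := by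
    simp only [hθ] at hmain
    linarith
  calc (Real.exp (η₂ a) - Real.exp (η₁ a)) * (Real.exp (η₃ b) - Real.exp (η₁ b))
      ≤ l * (Real.exp (η₃ a) - Real.exp (η₁ a)) * (Real.exp (η₃ b) - Real.exp (η₁ b)) := by
        gcongr
    _ = _ := by rw [← hlb]; ring

theorem isCharacteristic (h : IsCoefficientPair φ ψ) (hκ : ∀ t ∈ Icc a b, 0 < κ t)
    (hη : IsLogChar φ ψ κ a b η) (hb : 0 ≤ η b) :
    IsCharacteristic φ ψ κ a b fun r => logCoordInv ψ (η r) := by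
  intro r hr
  have h0 := hη.nonneg h hκ hb r hr
  have hm : logCoordInv ψ (η r) ∈ Ico (0 : ℝ) 1 := ⟨h.logCoordInv_nonneg h0, h.logCoordInv_lt _⟩
  refine ⟨hm, ?_⟩
  refine ((h.hasDerivAt_logCoordInv (η r)).comp_hasDerivWithinAt r (hη r hr)).congr_deriv ?_
  have hψ := (h.ψ_pos hm).ne'
  have hbp := h.b_pos.ne'
  simp only [speed, max_eq_left hm.1]
  generalize -d1 ψ 1 = b at hbp
  field_simp

end IsLogChar

theorem IsCoefficientPair.exists_isLogChar {φ ψ κ : ℝ → ℝ} (h : IsCoefficientPair φ ψ)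
    {K : NNReal} (hK : LipschitzWith K (speed φ ψ)) (hκ : ContinuousOn κ (Ici 0)) {t : ℝ}
    (ht : 0 ≤ t) (y : ℝ) : ∃ η : ℝ → ℝ, η t = y ∧ IsLogChar φ ψ κ 0 t η := by
  have hc : ContinuousOn κ (Icc 0 t) := hκ.mono Icc_subset_Ici_self
  obtain ⟨N, hN⟩ := (isCompact_Icc.image_of_continuousOn hc.norm).bddAbove
  have hN' : ∀ r ∈ Icc 0 t, ‖κ r‖ ≤ N := fun r hr => hN ⟨r, hr, rfl⟩
  have hN0 : 0 ≤ N := (norm_nonneg _).trans (hN' 0 (left_mem_Icc.2 ht))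
  have hb := h.b_pos
  have ha : 0 < -d1 φ 1 := by linarith [h.φ_slope_neg]
  set L : NNReal := ⟨-d1 φ 1 + -d1 ψ 1 * N, by positivity⟩ with hL
  -- the field is bounded, so a sufficiently large ball serves the whole time interval
  have hPL : IsPicardLindelof (fun r y => speed φ ψ y - -d1 ψ 1 * κ r)
      (⟨t, right_mem_Icc.2 ht⟩ : Icc 0 t) y (L * ⟨t, ht⟩) 0 L K := by
    refine ⟨fun r _ => ?_, fun z _ => ?_, fun r hr z _ => ?_, ?_⟩
    · refine LipschitzWith.lipschitzOnWith (LipschitzWith.of_dist_le_mul fun y z => ?_)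
      rw [Real.dist_eq, sub_sub_sub_cancel_right]
      exact hK.dist_le_mul y z
    · exact continuousOn_const.sub (continuousOn_const.mul hc)
    · have h1 := h.speed_nonneg z
      have h2 := h.speed_le z
      have h3 : -d1 ψ 1 * ‖κ r‖ ≤ -d1 ψ 1 * N := mul_le_mul_of_nonneg_left (hN' r hr) hb.le
      calc ‖speed φ ψ z - -d1 ψ 1 * κ r‖ ≤ ‖speed φ ψ z‖ + ‖-d1 ψ 1 * κ r‖ := norm_sub_le _ _
        _ ≤ -d1 φ 1 + -d1 ψ 1 * N := by
          rw [norm_mul, Real.norm_of_nonneg h1, Real.norm_of_nonneg hb.le]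
          linarith
    · simp only [sub_self, sub_zero, max_eq_right ht, NNReal.coe_zero]
      exact le_rfl
  obtain ⟨η, h1, h2⟩ := hPL.exists_eq_forall_mem_Icc_hasDerivWithinAt₀
  exact ⟨η, h1, h2⟩

/-! ### The backward flow -/

/-- The hypotheses under which the backward flow is studied: admissible coefficients with `Γ`
decreasing, a Lipschitz constant `K` for the velocity field in the logarithmic coordinate, and a
positive continuous rate `κ`. -/
structure FlowData (φ ψ : ℝ → ℝ) (K : NNReal) (κ : ℝ → ℝ) : Prop where
  coeff : IsCoefficientPair φ ψ
  anti : AntitoneOn (Gam φ ψ) (Ioo 0 1)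
  lip : LipschitzWith K (speed φ ψ)
  κ_cont : ContinuousOn κ (Ici 0)
  κ_pos : ∀ t, 0 ≤ t → 0 < κ t

/-- A characteristic on `[0, t]`, in the logarithmic coordinate, that is at `y` at time `t`. -/
noncomputable def logFlow (φ ψ κ : ℝ → ℝ) (t y : ℝ) : ℝ → ℝ :=
  Classical.epsilon fun η => η t = y ∧ IsLogChar φ ψ κ 0 t η

/-- The position at time `s ≤ t` of the characteristic that is at `x` at time `t`. -/
noncomputable def foot (φ ψ κ : ℝ → ℝ) (s t x : ℝ) : ℝ :=
  logCoordInv ψ (logFlow φ ψ κ t (logCoord ψ x) s)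

namespace FlowData

variable {φ ψ κ : ℝ → ℝ} {K : NNReal} (D : FlowData φ ψ K κ) {s t x : ℝ}
include D

theorem logFlow_spec (ht : 0 ≤ t) (y : ℝ) :
    logFlow φ ψ κ t y t = y ∧ IsLogChar φ ψ κ 0 t (logFlow φ ψ κ t y) :=
  Classical.epsilon_spec (p := fun η => η t = y ∧ IsLogChar φ ψ κ 0 t η)
    (D.coeff.exists_isLogChar D.lip D.κ_cont ht y)

theorem κ_pos_Icc {a b : ℝ} (ha : 0 ≤ a) : ∀ r ∈ Icc a b, 0 < κ r := fun r hr =>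
  D.κ_pos r (ha.trans hr.1)

theorem logCoord_foot (s t x : ℝ) :
    logCoord ψ (foot φ ψ κ s t x) = logFlow φ ψ κ t (logCoord ψ x) s :=
  D.coeff.logCoord_logCoordInv _

theorem foot_self (ht : 0 ≤ t) (hx : x ∈ Ico (0 : ℝ) 1) : foot φ ψ κ t t x = x := by
  rw [foot, (D.logFlow_spec ht _).1, D.coeff.logCoordInv_logCoord hx.2]

theorem isCharacteristic_foot (ht : 0 ≤ t) (hs : 0 ≤ s) (hx : x ∈ Ico (0 : ℝ) 1) :
    IsCharacteristic φ ψ κ s t fun r => foot φ ψ κ r t x := by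
  obtain ⟨h1, h2⟩ := D.logFlow_spec ht (logCoord ψ x)
  exact (h2.mono hs le_rfl).isCharacteristic D.coeff (D.κ_pos_Icc hs)
    (by rw [h1]; exact D.coeff.logCoord_nonneg hx)

theorem foot_mem (hs : 0 ≤ s) (hst : s ≤ t) (hx : x ∈ Ico (0 : ℝ) 1) :
    foot φ ψ κ s t x ∈ Ico (0 : ℝ) 1 :=
  (D.isCharacteristic_foot (hs.trans hst) hs hx s (left_mem_Icc.2 hst)).1

theorem monotoneOn_foot (hs : 0 ≤ s) (hst : s ≤ t) :
    MonotoneOn (foot φ ψ κ s t) (Ico 0 1) := by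
  intro x hx y hy hxy
  have h1 := D.logFlow_spec (hs.trans hst) (logCoord ψ x)
  have h2 := D.logFlow_spec (hs.trans hst) (logCoord ψ y)
  refine D.coeff.strictMono_logCoordInv.monotone (h1.2.le_of_le D.lip h2.2 ?_ s ⟨hs, hst⟩)
  rw [h1.1, h2.1]
  exact D.coeff.strictMonoOn_logCoord.monotoneOn hx.2 hy.2 hxy

theorem logCoord_foot_sub_le (hs : 0 ≤ s) (hst : s ≤ t) {y : ℝ} (hx : x ∈ Ico (0 : ℝ) 1)
    (hy : y ∈ Ico (0 : ℝ) 1) (hxy : x ≤ y) :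
    logCoord ψ (foot φ ψ κ s t y) - logCoord ψ (foot φ ψ κ s t x) ≤
      Real.exp (K * (t - s)) * (logCoord ψ y - logCoord ψ x) := by
  have h1 := D.logFlow_spec (hs.trans hst) (logCoord ψ x)
  have h2 := D.logFlow_spec (hs.trans hst) (logCoord ψ y)
  rw [D.logCoord_foot, D.logCoord_foot]
  have := (h1.2.mono hs le_rfl).sub_le_exp_mul D.lip (h2.2.mono hs le_rfl) ?_ hst
  · rwa [h1.1, h2.1] at this
  · rw [h1.1, h2.1]
    exact D.coeff.strictMonoOn_logCoord.monotoneOn hx.2 hy.2 hxy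

/-- The backward flow is convex in the coordinate `expCoord ψ`. -/
theorem foot_convex (hs : 0 ≤ s) (hst : s ≤ t) {x₁ x₂ x₃ : ℝ} (h1 : 0 ≤ x₁) (h12 : x₁ ≤ x₂)
    (h23 : x₂ < x₃) (h3 : x₃ < 1) :
    (expCoord ψ (foot φ ψ κ s t x₂) - expCoord ψ (foot φ ψ κ s t x₁)) *
        (expCoord ψ x₃ - expCoord ψ x₁) ≤
      (expCoord ψ x₂ - expCoord ψ x₁) *
        (expCoord ψ (foot φ ψ κ s t x₃) - expCoord ψ (foot φ ψ κ s t x₁)) := by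
  have ht := hs.trans hst
  have g1 := D.logFlow_spec ht (logCoord ψ x₁)
  have g2 := D.logFlow_spec ht (logCoord ψ x₂)
  have g3 := D.logFlow_spec ht (logCoord ψ x₃)
  have m1 : x₁ < 1 := by linarith
  have m2 : x₂ < 1 := by linarith
  have hm := D.coeff.strictMonoOn_logCoord
  have := IsLogChar.exp_convex D.coeff D.anti
    (D.κ_cont.mono fun r hr => hs.trans hr.1) (D.κ_pos_Icc hs) hst
    (g1.2.mono hs le_rfl) (g2.2.mono hs le_rfl) (g3.2.mono hs le_rfl)
    (by rw [g1.1]; exact D.coeff.logCoord_nonneg ⟨h1, m1⟩)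
    (by rw [g1.1, g2.1]; exact hm.monotoneOn m1 m2 h12)
    (by rw [g2.1, g3.1]; exact hm m2 h3 h23)
  rw [g1.1, g2.1, g3.1] at this
  simpa only [expCoord, D.logCoord_foot] using this

theorem foot_comp (hs : 0 ≤ s) (hst : s ≤ t) (x : ℝ) :
    foot φ ψ κ 0 s (foot φ ψ κ s t x) = foot φ ψ κ 0 t x := by
  have h1 := D.logFlow_spec (hs.trans hst) (logCoord ψ x)
  have h2 := D.logFlow_spec hs (logCoord ψ (foot φ ψ κ s t x))
  rw [foot, foot]
  congr 1
  refine h2.2.eqOn D.lip (h1.2.mono le_rfl hst) ?_ (left_mem_Icc.2 hs)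
  rw [h2.1, D.logCoord_foot]

theorem hasDerivWithinAt_foot (hs : 0 ≤ s) (hst : s ≤ t) (hx : x ∈ Ico (0 : ℝ) 1) :
    ∀ r ∈ Icc s t, HasDerivWithinAt (fun r => foot φ ψ κ r t x)
      (φ (foot φ ψ κ r t x) - κ (max r 0) * ψ (foot φ ψ κ r t x)) (Icc s t) r := by
  intro r hr
  rw [max_eq_left (hs.trans hr.1)]
  exact (D.isCharacteristic_foot (hs.trans hst) hs hx r hr).2

/-- The bounds `φ ≤ a (1 - x)` and `ψ ≥ b (1 - x)` turn into a bound, linear in `1 - x`, for the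
distance of the backward flow to `1`. -/
theorem one_sub_foot_le (hs : 0 ≤ s) (hst : s ≤ t) (hx : x ∈ Ico (0 : ℝ) 1) :
    1 - foot φ ψ κ s t x ≤
      Real.exp (-d1 φ 1 * (t - s) - -d1 ψ 1 * (cumul κ t - cumul κ s)) * (1 - x) := by
  set E : ℝ → ℝ := fun r => Real.exp (-d1 φ 1 * r - -d1 ψ 1 * cumul κ r) with hE
  have hEd : ∀ r, HasDerivAt E (E r * (-d1 φ 1 * 1 - -d1 ψ 1 * κ (max r 0))) r := fun r =>
    (((hasDerivAt_id r).const_mul _).sub ((hasDerivAt_cumul D.κ_cont r).const_mul _)).exp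
  have hm : MonotoneOn (fun r => (1 - foot φ ψ κ r t x) * E r) (Icc s t) := by
    refine monotoneOn_of_hasDerivWithinAt_Icc (fun r hr =>
      ((D.hasDerivWithinAt_foot hs hst hx r hr).const_sub 1).mul
        (hEd r).hasDerivWithinAt) fun r hr => ?_
    have hr0 : 0 ≤ r := hs.trans hr.1
    have hmem := D.foot_mem hr0 hr.2 hx
    have hmem' : foot φ ψ κ r t x ∈ Icc (0 : ℝ) 1 := ⟨hmem.1, hmem.2.le⟩
    have h1 := D.coeff.φ_le hmem'
    have h2 := D.coeff.le_ψ hmem'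
    have hκ := D.κ_pos _ (le_max_right r 0)
    have h3 : 0 ≤ ((-d1 φ 1 * (1 - foot φ ψ κ r t x) - φ (foot φ ψ κ r t x)) +
        κ (max r 0) * (ψ (foot φ ψ κ r t x) - -d1 ψ 1 * (1 - foot φ ψ κ r t x))) * E r :=
      mul_nonneg (add_nonneg (sub_nonneg.2 h1) (mul_nonneg hκ.le (sub_nonneg.2 h2)))
        (Real.exp_pos _).le
    linarith
  have h4 := hm (left_mem_Icc.2 hst) (right_mem_Icc.2 hst) hst
  simp only [D.foot_self (hs.trans hst) hx] at h4
  have h5 : Real.exp (-d1 φ 1 * (t - s) - -d1 ψ 1 * (cumul κ t - cumul κ s)) = E t / E s := by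
    rw [hE, ← Real.exp_sub]
    congr 1
    ring
  rw [h5, div_mul_eq_mul_div, le_div_iff₀ (Real.exp_pos _)]
  linarith

theorem foot_le (hs : 0 ≤ s) (hst : s ≤ t) (hx : x ∈ Ico (0 : ℝ) 1) :
    foot φ ψ κ s t x ≤ x + ψ 0 * (cumul κ t - cumul κ s) := by
  have hm : MonotoneOn (fun r => foot φ ψ κ r t x + ψ 0 * cumul κ r) (Icc s t) := by
    refine monotoneOn_of_hasDerivWithinAt_Icc (fun r hr =>
      (D.hasDerivWithinAt_foot hs hst hx r hr).add
        ((hasDerivAt_cumul D.κ_cont r).const_mul _).hasDerivWithinAt) fun r hr => ?_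
    have hr0 : 0 ≤ r := hs.trans hr.1
    have hmem := D.foot_mem hr0 hr.2 hx
    have hmem' : foot φ ψ κ r t x ∈ Icc (0 : ℝ) 1 := ⟨hmem.1, hmem.2.le⟩
    have h1 := D.coeff.φ_nonneg hmem'
    have h2 := D.coeff.ψ_le hmem'
    have hκ := D.κ_pos _ (le_max_right r 0)
    have h3 : ψ (foot φ ψ κ r t x) ≤ ψ 0 := by nlinarith [D.coeff.ψ_zero_pos, hmem.1]
    nlinarith
  have h4 := hm (left_mem_Icc.2 hst) (right_mem_Icc.2 hst) hst
  simp only [D.foot_self (hs.trans hst) hx] at h4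
  linarith

theorem logCoord_foot_zero_le (hs : 0 ≤ s) (hst : s ≤ t) :
    logCoord ψ (foot φ ψ κ s t 0) ≤ -d1 ψ 1 * (cumul κ t - cumul κ s) := by
  have ht := hs.trans hst
  have g := D.logFlow_spec ht (logCoord ψ 0)
  have hm : MonotoneOn (fun r => logFlow φ ψ κ t (logCoord ψ 0) r + -d1 ψ 1 * cumul κ r)
      (Icc s t) := by
    refine monotoneOn_of_hasDerivWithinAt_Icc (fun r hr =>
      (g.2.mono hs le_rfl r hr).add
        ((hasDerivAt_cumul D.κ_cont r).const_mul _).hasDerivWithinAt) fun r hr => ?_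
    rw [max_eq_left (hs.trans hr.1)]
    linarith [D.coeff.speed_nonneg (logFlow φ ψ κ t (logCoord ψ 0) r)]
  have h4 := hm (left_mem_Icc.2 hst) (right_mem_Icc.2 hst) hst
  simp only [g.1] at h4
  rw [D.logCoord_foot]
  simp only [logCoord_zero] at h4 ⊢
  linarith

theorem continuousOn_foot (ht : 0 ≤ t) : ContinuousOn (foot φ ψ κ 0 t) (Ico 0 1) := by
  have h1 : ContinuousOn (fun x => logCoord ψ (foot φ ψ κ 0 t x)) (Ico 0 1) := by
    intro x hx
    have hcl : ContinuousWithinAt (fun y => Real.exp (K * (t - 0)) *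
        |logCoord ψ y - logCoord ψ x|) (Ico 0 1) x :=
      continuousWithinAt_const.mul (((D.coeff.continuousOn_logCoord.mono
        fun y hy => hy.2) x hx).sub continuousWithinAt_const).abs
    rw [ContinuousWithinAt, tendsto_iff_dist_tendsto_zero]
    refine squeeze_zero' (Eventually.of_forall fun _ => dist_nonneg) ?_
      (by simpa [ContinuousWithinAt] using hcl)
    filter_upwards [self_mem_nhdsWithin] with y hy
    have hmono := D.coeff.strictMonoOn_logCoord.monotoneOn
    have hf := D.monotoneOn_foot le_rfl ht
    have hm := fun z hz => D.foot_mem (x := z) le_rfl ht hz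
    rw [Real.dist_eq]
    rcases le_total x y with hxy | hxy
    · rw [abs_of_nonneg (sub_nonneg.2 (hmono (hm x hx).2 (hm y hy).2 (hf hx hy hxy))),
        abs_of_nonneg (sub_nonneg.2 (hmono hx.2 hy.2 hxy))]
      simpa using D.logCoord_foot_sub_le le_rfl ht hx hy hxy
    · rw [abs_sub_comm, abs_sub_comm (logCoord ψ y),
        abs_of_nonneg (sub_nonneg.2 (hmono (hm y hy).2 (hm x hx).2 (hf hy hx hxy))),
        abs_of_nonneg (sub_nonneg.2 (hmono hy.2 hx.2 hxy))]
      simpa using D.logCoord_foot_sub_le le_rfl ht hy hx hxy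
  refine (D.coeff.continuous_logCoordInv.comp_continuousOn h1).congr fun x hx => ?_
  exact (D.coeff.logCoordInv_logCoord (D.foot_mem le_rfl ht hx).2).symm

theorem logCoord_foot_zero_sub (hs : 0 ≤ s) (hst : s ≤ t) :
    |logCoord ψ (foot φ ψ κ 0 t 0) - logCoord ψ (foot φ ψ κ 0 s 0)| ≤
      Real.exp (K * s) * (-d1 ψ 1 * (cumul κ t - cumul κ s)) := by
  have h0 : (0 : ℝ) ∈ Ico (0 : ℝ) 1 := ⟨le_rfl, one_pos⟩
  have hy := D.foot_mem hs hst h0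
  rw [← D.foot_comp hs hst 0]
  have h1 := D.logCoord_foot_sub_le le_rfl hs h0 hy hy.1
  have h2 := D.coeff.strictMonoOn_logCoord.monotoneOn (D.foot_mem le_rfl hs h0).2
    (D.foot_mem le_rfl hs hy).2 (D.monotoneOn_foot le_rfl hs h0 hy hy.1)
  rw [abs_of_nonneg (sub_nonneg.2 h2)]
  refine h1.trans ?_
  rw [logCoord_zero, sub_zero, sub_zero]
  gcongr
  exact D.logCoord_foot_zero_le hs hst

theorem continuousOn_foot_zero : ContinuousOn (fun t => foot φ ψ κ 0 t 0) (Ici 0) := by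
  have h0 : (0 : ℝ) ∈ Ico (0 : ℝ) 1 := ⟨le_rfl, one_pos⟩
  have hb := D.coeff.b_pos
  have hcm := (strictMono_cumul D.κ_cont D.κ_pos).monotone
  have hcc : Continuous (cumul κ) :=
    continuous_iff_continuousAt.2 fun r => (hasDerivAt_cumul D.κ_cont r).continuousAt
  have h1 : ContinuousOn (fun t => logCoord ψ (foot φ ψ κ 0 t 0)) (Ici 0) := by
    intro t (ht : 0 ≤ t)
    have hcl : Tendsto (fun s => Real.exp (K * max s t) *
        (-d1 ψ 1 * |cumul κ s - cumul κ t|)) (𝓝 t) (𝓝 0) := by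
      have : Continuous fun s => Real.exp (K * max s t) *
        (-d1 ψ 1 * |cumul κ s - cumul κ t|) := by fun_prop
      simpa using this.tendsto t
    rw [ContinuousWithinAt, tendsto_iff_dist_tendsto_zero]
    refine squeeze_zero' (Eventually.of_forall fun _ => dist_nonneg) ?_
      (tendsto_nhdsWithin_of_tendsto_nhds hcl)
    filter_upwards [self_mem_nhdsWithin] with s (hs : 0 ≤ s)
    rw [Real.dist_eq]
    rcases le_total s t with hst | hst
    · rw [abs_sub_comm, abs_sub_comm (cumul κ s), abs_of_nonneg (sub_nonneg.2 (hcm hst))]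
      refine (D.logCoord_foot_zero_sub hs hst).trans ?_
      have := mul_nonneg hb.le (sub_nonneg.2 (hcm hst))
      exact mul_le_mul_of_nonneg_right (Real.exp_le_exp.2
        (mul_le_mul_of_nonneg_left (le_max_left _ _) K.coe_nonneg)) this
    · rw [abs_of_nonneg (sub_nonneg.2 (hcm hst))]
      refine (D.logCoord_foot_zero_sub ht hst).trans ?_
      have := mul_nonneg hb.le (sub_nonneg.2 (hcm hst))
      exact mul_le_mul_of_nonneg_right (Real.exp_le_exp.2
        (mul_le_mul_of_nonneg_left (le_max_right _ _) K.coe_nonneg)) this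
  refine (D.coeff.continuous_logCoordInv.comp_continuousOn h1).congr fun t ht => ?_
  exact (D.coeff.logCoordInv_logCoord (D.foot_mem le_rfl ht h0).2).symm

end FlowData

/-! ### The initial density near the right end point -/

theorem tail_one (c₀ : ℝ → ℝ) : tail c₀ 1 = 0 := by simp [tail]

namespace IsInitialDensity

variable {c₀ : ℝ → ℝ} (hc : IsInitialDensity c₀)
include hc

theorem intervalIntegrable_of_mem {x y : ℝ} (hx : x ∈ Icc (0 : ℝ) 1) (hy : y ∈ Icc (0 : ℝ) 1) :
    IntervalIntegrable c₀ MeasureTheory.volume x y :=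
  hc.integrable.mono_set (by
    rw [uIcc_of_le (zero_le_one (α := ℝ))]
    exact ordConnected_Icc.uIcc_subset hx hy)

theorem tail_sub_tail {x y : ℝ} (hx : x ∈ Icc (0 : ℝ) 1) (hy : y ∈ Icc (0 : ℝ) 1) :
    tail c₀ x - tail c₀ y = ∫ z in x..y, c₀ z := by
  have h1 : (1 : ℝ) ∈ Icc (0 : ℝ) 1 := ⟨zero_le_one, le_rfl⟩
  rw [tail, tail, sub_eq_iff_eq_add, intervalIntegral.integral_add_adjacent_intervals
    (hc.intervalIntegrable_of_mem hx hy) (hc.intervalIntegrable_of_mem hy h1)]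

theorem continuousOn_tail : ContinuousOn (tail c₀) (Icc 0 1) := by
  have h1 : ContinuousOn (fun x => ∫ z in (0 : ℝ)..x, c₀ z) (Icc 0 1) := by
    have := intervalIntegral.continuousOn_primitive_interval (a := (0 : ℝ)) (b := 1) (f := c₀)
      (μ := MeasureTheory.volume) (by
        rw [uIcc_of_le (zero_le_one (α := ℝ))]
        exact (intervalIntegrable_iff_integrableOn_Icc_of_le zero_le_one).1 hc.integrable)
    rwa [uIcc_of_le (zero_le_one (α := ℝ))] at this
  refine (continuousOn_const (c := tail c₀ 0)).fun_sub h1 |>.congr fun x hx => ?_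
  have := hc.tail_sub_tail ⟨le_rfl, zero_le_one⟩ hx
  change tail c₀ x = tail c₀ 0 - ∫ z in (0 : ℝ)..x, c₀ z
  linarith

theorem antitoneOn_tail : AntitoneOn (tail c₀) (Icc 0 1) := by
  intro x hx y hy hxy
  rw [← sub_nonneg, hc.tail_sub_tail hx hy]
  have : ∫ _z in x..y, (0 : ℝ) ≤ ∫ z in x..y, c₀ z :=
    intervalIntegral.integral_mono_on_of_le_Ioo hxy (by simp) (hc.intervalIntegrable_of_mem hx hy)
      fun z hz => hc.nonneg z ⟨hx.1.trans_lt hz.1, hz.2.trans_le hy.2⟩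
  simpa using this

theorem intervalIntegrable_tail {x y : ℝ} (hx : x ∈ Icc (0 : ℝ) 1) (hy : y ∈ Icc (0 : ℝ) 1) :
    IntervalIntegrable (tail c₀) MeasureTheory.volume x y :=
  (hc.continuousOn_tail.mono (ordConnected_Icc.uIcc_subset hx hy)).intervalIntegrable

theorem tail_tail_pos {x : ℝ} (hx : x ∈ Ico (0 : ℝ) 1) : 0 < tail (tail c₀) x := by
  refine intervalIntegral.intervalIntegral_pos_of_pos_on
    (hc.intervalIntegrable_tail ⟨hx.1, hx.2.le⟩ ⟨zero_le_one, le_rfl⟩) ?_ hx.2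
  exact fun z hz => hc.tail_pos z ⟨hx.1.trans hz.1.le, hz.2⟩

theorem tail_tail_le {x : ℝ} (hx : x ∈ Icc (0 : ℝ) 1) :
    tail (tail c₀) x ≤ tail c₀ x * (1 - x) := by
  have : ∫ z in x..1, tail c₀ z ≤ ∫ _z in x..1, tail c₀ x :=
    intervalIntegral.integral_mono_on hx.2
      (hc.intervalIntegrable_tail hx ⟨zero_le_one, le_rfl⟩) (by simp)
      fun z hz => hc.antitoneOn_tail hx ⟨hx.1.trans hz.1, hz.2⟩ hz.1
  rw [intervalIntegral.integral_const, smul_eq_mul, mul_comm] at this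
  exact this

theorem tail_tail_anti {x y : ℝ} (hx : 0 ≤ x) (hxy : x ≤ y) (hy : y ≤ 1) :
    tail (tail c₀) y ≤ tail (tail c₀) x := by
  have h1 : tail (tail c₀) x = (∫ z in x..y, tail c₀ z) + tail (tail c₀) y :=
    (intervalIntegral.integral_add_adjacent_intervals
      (hc.intervalIntegrable_tail ⟨hx, hxy.trans hy⟩ ⟨hx.trans hxy, hy⟩)
      (hc.intervalIntegrable_tail ⟨hx.trans hxy, hy⟩ ⟨zero_le_one, le_rfl⟩)).symm
  have h2 : 0 ≤ ∫ z in x..y, tail c₀ z := by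
    refine intervalIntegral.integral_nonneg hxy fun z hz => ?_
    rw [← tail_one c₀]
    exact hc.antitoneOn_tail ⟨hx.trans hz.1, hz.2.trans hy⟩ ⟨zero_le_one, le_rfl⟩ (hz.2.trans hy)
  linarith

theorem one_lt_tail_zero : 1 < tail c₀ 0 := by
  by_contra! hle
  have h0 : (0 : ℝ) ∈ Icc (0 : ℝ) 1 := ⟨le_rfl, zero_le_one⟩
  have : ∫ x in (0 : ℝ)..1, tail c₀ x < ∫ _x in (0 : ℝ)..1, (1 : ℝ) := by
    refine intervalIntegral.integral_lt_integral_of_continuousOn_of_le_of_exists_lt one_pos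
      hc.continuousOn_tail continuousOn_const (fun x hx => ?_) ⟨1, ⟨zero_le_one, le_rfl⟩, ?_⟩
    · exact (hc.antitoneOn_tail h0 ⟨hx.1.le, hx.2⟩ hx.1.le).trans hle
    · rw [tail_one]; exact one_pos
  rw [hc.mass] at this
  simp at this

/-- Bounds on the increments of `w₀` that follow from `1/2 ≤ β ≤ 2` near `1`. -/
theorem exists_tail_sub_bounds (hβ : Tendsto (betaFn c₀) (𝓝[<] 1) (𝓝 1)) :
    ∃ l ∈ Ico (0 : ℝ) 1, ∀ x y, l ≤ x → x ≤ y → y < 1 →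
      tail c₀ x - tail c₀ y ≤ 2 * (tail c₀ x) ^ 2 / tail (tail c₀) y * (y - x) ∧
      (tail c₀ y) ^ 2 / (2 * tail (tail c₀) x) * (y - x) ≤ tail c₀ x - tail c₀ y := by
  have h1 : ∀ᶠ x in 𝓝[<] (1 : ℝ), betaFn c₀ x ∈ Ioo (1 / 2 : ℝ) 2 :=
    hβ (Ioo_mem_nhds (by norm_num) (by norm_num))
  obtain ⟨l, hl, hl'⟩ := mem_nhdsLT_iff_exists_Ioo_subset.1 h1
  refine ⟨max l 0, max_zero_mem hl, fun x y hx hxy hy => ?_⟩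
  have hx0 : 0 ≤ x := (le_max_right _ _).trans hx
  have hxI : x ∈ Icc (0 : ℝ) 1 := ⟨hx0, hxy.trans hy.le⟩
  have hyI : y ∈ Icc (0 : ℝ) 1 := ⟨hx0.trans hxy, hy.le⟩
  have hint := hc.intervalIntegrable_of_mem hxI hyI
  have key : ∀ z ∈ Ioo x y, c₀ z ≤ 2 * (tail c₀ x) ^ 2 / tail (tail c₀) y ∧
      (tail c₀ y) ^ 2 / (2 * tail (tail c₀) x) ≤ c₀ z := by
    intro z hz
    have hz1 : z < 1 := hz.2.trans hy
    have hz0 : 0 ≤ z := hx0.trans hz.1.le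
    obtain ⟨hβ1, hβ2⟩ : betaFn c₀ z ∈ Ioo (1 / 2 : ℝ) 2 :=
      hl' ⟨((le_max_left l 0).trans hx).trans_lt hz.1, hz1⟩
    have hw := hc.tail_pos z ⟨hz0, hz1⟩
    have hwx : tail c₀ z ≤ tail c₀ x := hc.antitoneOn_tail hxI ⟨hz0, hz1.le⟩ hz.1.le
    have hwy : tail c₀ y ≤ tail c₀ z := hc.antitoneOn_tail ⟨hz0, hz1.le⟩ hyI hz.2.le
    have hwy0 := hc.tail_pos y ⟨hyI.1, hy⟩
    have hhz := hc.tail_tail_pos ⟨hz0, hz1⟩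
    have hhy := hc.tail_tail_pos ⟨hyI.1, hy⟩
    have hhx := hc.tail_tail_anti hx0 hz.1.le hz1.le
    have hhzy := hc.tail_tail_anti hz0 hz.2.le hy.le
    rw [betaFn, lt_div_iff₀ (by positivity)] at hβ1
    rw [betaFn, div_lt_iff₀ (by positivity)] at hβ2
    have hcz := hc.nonneg z ⟨hx0.trans_lt hz.1, hz1⟩
    constructor
    · rw [le_div_iff₀ hhy]
      calc c₀ z * tail (tail c₀) y ≤ c₀ z * tail (tail c₀) z := by gcongr
        _ ≤ 2 * tail c₀ z ^ 2 := hβ2.le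
        _ ≤ 2 * tail c₀ x ^ 2 := by gcongr
    · rw [div_le_iff₀ (by linarith)]
      calc tail c₀ y ^ 2 ≤ tail c₀ z ^ 2 := by gcongr
        _ ≤ 2 * (c₀ z * tail (tail c₀) z) := by linarith [hβ1]
        _ ≤ 2 * (c₀ z * tail (tail c₀) x) := by gcongr
        _ = c₀ z * (2 * tail (tail c₀) x) := by ring
  rw [hc.tail_sub_tail hxI hyI]
  constructor
  · have := intervalIntegral.integral_mono_on_of_le_Ioo hxy hint
      (intervalIntegrable_const (c := 2 * (tail c₀ x) ^ 2 / tail (tail c₀) y))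
      fun z hz => (key z hz).1
    rwa [intervalIntegral.integral_const, smul_eq_mul, mul_comm] at this
  · have := intervalIntegral.integral_mono_on_of_le_Ioo hxy
      (intervalIntegrable_const (c := (tail c₀ y) ^ 2 / (2 * tail (tail c₀) x))) hint
      fun z hz => (key z hz).2
    rwa [intervalIntegral.integral_const, smul_eq_mul, mul_comm] at this

/-- Near `1`, and as long as `w₀` does not vary by more than a factor, the slopes of `w₀` with
respect to the coordinate `expCoord ψ` decay at most by a constant factor from left to right. -/
theorem exists_slope_comparison {φ ψ : ℝ → ℝ} (h : IsCoefficientPair φ ψ)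
    (hβ : Tendsto (betaFn c₀) (𝓝[<] 1) (𝓝 1)) :
    ∃ l ∈ Ico (0 : ℝ) 1, ∃ q : ℝ, 0 < q ∧ ∀ x y z, l ≤ x → x ≤ y → y ≤ z → z < 1 →
      9 / 10 * tail c₀ x ≤ tail c₀ z →
      q * (expCoord ψ z - expCoord ψ y) * (tail c₀ x - tail c₀ y) ≤
        (tail c₀ y - tail c₀ z) * (expCoord ψ y - expCoord ψ x) := by
  obtain ⟨l, hl, hbd⟩ := hc.exists_tail_sub_bounds hβ
  obtain ⟨e, he, hE⟩ := h.exists_le_expCoord_sub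
  refine ⟨l, hl, e / 20, by positivity, fun x y z hlx hxy hyz hz hw => ?_⟩
  have hx0 : 0 ≤ x := hl.1.trans hlx
  have hy0 : 0 ≤ y := hx0.trans hxy
  have hx1 : x < 1 := by linarith
  have hy1 : y < 1 := by linarith
  have hwx := hc.tail_pos x ⟨hx0, hx1⟩
  have hwz := hc.tail_pos z ⟨hy0.trans hyz, hz⟩
  have hhx := hc.tail_tail_pos ⟨hx0, hx1⟩
  have hhy := hc.tail_tail_pos ⟨hy0, hy1⟩
  have hsq : (81 / 100 : ℝ) * tail c₀ x ^ 2 ≤ tail c₀ z ^ 2 := by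
    calc (81 / 100 : ℝ) * tail c₀ x ^ 2 = (9 / 10 * tail c₀ x) ^ 2 := by ring
      _ ≤ tail c₀ z ^ 2 := by gcongr
  -- `w₀` is nearly constant on `[x, z]`, so `z` is not much closer to `1` than `x` is
  have hhalf : (1 - x) / 2 ≤ 1 - z := by
    have h1 := (hbd x z hlx (hxy.trans hyz) hz).2
    have h2 := hc.tail_tail_le ⟨hx0, hx1.le⟩
    rw [div_mul_eq_mul_div, div_le_iff₀ (by positivity)] at h1
    have h3 : (81 / 100 : ℝ) * tail c₀ x ^ 2 * (z - x) ≤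
        tail c₀ x / 10 * (2 * (tail c₀ x * (1 - x))) := by
      calc (81 / 100 : ℝ) * tail c₀ x ^ 2 * (z - x) ≤ tail c₀ z ^ 2 * (z - x) := by
            have : 0 ≤ z - x := by linarith
            gcongr
        _ ≤ (tail c₀ x - tail c₀ z) * (2 * tail (tail c₀) x) := h1
        _ ≤ tail c₀ x / 10 * (2 * (tail c₀ x * (1 - x))) := by
            gcongr
            linarith
    have h4 : tail c₀ x ^ 2 * (81 / 100 * (z - x)) ≤ tail c₀ x ^ 2 * (1 / 5 * (1 - x)) := by
      linarith
    have h5 := le_of_mul_le_mul_left h4 (by positivity)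
    linarith
  have hux : 0 < 1 - x := by linarith
  have huz : 0 < 1 - z := by linarith
  set A := tail c₀ x ^ 2 / tail (tail c₀) y with hA
  set U := 1 / (1 - x) ^ 2 with hU
  have hA0 : 0 ≤ A := by positivity
  have hU0 : 0 ≤ U := by positivity
  have e1 : e * U * (y - x) ≤ expCoord ψ y - expCoord ψ x := by
    have := hE x y hx0 hxy hy1
    rwa [hU, mul_one_div]
  have e2 : expCoord ψ z - expCoord ψ y ≤ 4 * U * (z - y) := by
    refine (h.expCoord_sub_le hy0 hyz hz).trans ?_
    have : 0 ≤ z - y := by linarith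
    gcongr
    rw [hU, mul_one_div, div_le_div_iff₀ (by positivity) (by positivity)]
    nlinarith
  have e3 : tail c₀ x - tail c₀ y ≤ 2 * A * (y - x) := by
    have := (hbd x y hlx hxy hy1).1
    rwa [hA, ← mul_div_assoc]
  have e4 : 2 / 5 * A * (z - y) ≤ tail c₀ y - tail c₀ z := by
    refine le_trans ?_ (hbd y z (hlx.trans hxy) hyz hz).2
    have : 0 ≤ z - y := by linarith
    gcongr
    rw [hA, ← mul_div_assoc, div_le_div_iff₀ hhy (by positivity)]
    nlinarith
  have hzy : 0 ≤ z - y := by linarith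
  have hyx : 0 ≤ y - x := by linarith
  have hd0 : 0 ≤ tail c₀ x - tail c₀ y :=
    sub_nonneg.2 (hc.antitoneOn_tail ⟨hx0, hx1.le⟩ ⟨hy0, hy1.le⟩ hxy)
  calc e / 20 * (expCoord ψ z - expCoord ψ y) * (tail c₀ x - tail c₀ y)
      ≤ e / 20 * (4 * U * (z - y)) * (2 * A * (y - x)) := by gcongr
    _ = (2 / 5 * A * (z - y)) * (e * U * (y - x)) := by ring
    _ ≤ (tail c₀ y - tail c₀ z) * (expCoord ψ y - expCoord ψ x) :=
        mul_le_mul e4 e1 (by positivity) ((by positivity : (0 : ℝ) ≤ _).trans e4)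

end IsInitialDensity

/-! ### Solutions along the backward flow -/

/-- A solution of the problem with rate `κ`, together with the data of its backward flow. -/
structure SolutionData (φ ψ : ℝ → ℝ) (K : NNReal) (c₀ : ℝ → ℝ) (w : ℝ → ℝ → ℝ) (κ : ℝ → ℝ) :
    Prop where
  flow : FlowData φ ψ K κ
  init : IsInitialDensity c₀
  sol : IsSolution φ ψ (tail c₀) w κ

namespace SolutionData

variable {φ ψ c₀ κ : ℝ → ℝ} {K : NNReal} {w : ℝ → ℝ → ℝ} (S : SolutionData φ ψ K c₀ w κ)
  {s t x y : ℝ}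
include S

theorem w_eq_exp_mul_foot (hs : 0 ≤ s) (hst : s ≤ t) (hx : x ∈ Ico (0 : ℝ) 1) :
    w x t = Real.exp (t - s) * w (foot φ ψ κ s t x) s := by
  rcases hst.eq_or_lt with rfl | hlt
  · simp [S.flow.foot_self hs hx]
  have ht := hs.trans hst
  have htr := S.sol.transport s t _ hs hlt (S.flow.isCharacteristic_foot ht hs hx)
  have hd : ∀ r ∈ Icc s t, HasDerivWithinAt (fun r => w (foot φ ψ κ r t x) r * Real.exp (-r)) 0
      (Icc s t) r := fun r hr =>
    ((htr r hr).mul ((hasDerivAt_neg r).exp).hasDerivWithinAt).congr_deriv (by ring)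
  have hconst := constant_of_has_deriv_right_zero
    (fun r hr => (hd r hr).continuousWithinAt)
    (fun r hr => (hd r ⟨hr.1, hr.2.le⟩).mono_of_mem_nhdsWithin (Icc_mem_nhdsGE_of_mem hr))
    t (right_mem_Icc.2 hst)
  simp only [S.flow.foot_self ht hx, Real.exp_neg] at hconst
  rw [Real.exp_sub]
  have h1 := Real.exp_pos t
  have h2 := Real.exp_pos s
  field_simp at hconst ⊢
  linarith

theorem w_eq (ht : 0 ≤ t) (hx : x ∈ Ico (0 : ℝ) 1) :
    w x t = Real.exp t * tail c₀ (foot φ ψ κ 0 t x) := by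
  rw [S.w_eq_exp_mul_foot le_rfl ht hx, S.sol.initial _ (S.flow.foot_mem le_rfl ht hx), sub_zero]

theorem w_pos (ht : 0 ≤ t) (hx : x ∈ Ico (0 : ℝ) 1) : 0 < w x t := by
  rw [S.w_eq ht hx]
  exact mul_pos (Real.exp_pos _) (S.init.tail_pos _ (S.flow.foot_mem le_rfl ht hx))

theorem antitoneOn_w (ht : 0 ≤ t) : AntitoneOn (fun x => w x t) (Ico 0 1) := by
  intro x hx y hy hxy
  simp only [S.w_eq ht hx, S.w_eq ht hy]
  have hx' := S.flow.foot_mem le_rfl ht hx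
  have hy' := S.flow.foot_mem le_rfl ht hy
  exact mul_le_mul_of_nonneg_left (S.init.antitoneOn_tail ⟨hx'.1, hx'.2.le⟩ ⟨hy'.1, hy'.2.le⟩
    (S.flow.monotoneOn_foot le_rfl ht hx hy hxy)) (Real.exp_pos _).le

theorem continuousOn_w (ht : 0 ≤ t) : ContinuousOn (fun x => w x t) (Ico 0 1) := by
  refine (continuousOn_const.mul (S.init.continuousOn_tail.comp (S.flow.continuousOn_foot ht)
    fun x hx => ?_)).congr fun x hx => S.w_eq ht hx
  have := S.flow.foot_mem le_rfl ht hx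
  exact ⟨this.1, this.2.le⟩

theorem continuousOn_w_zero : ContinuousOn (fun t => w 0 t) (Ici 0) := by
  have h0 : (0 : ℝ) ∈ Ico (0 : ℝ) 1 := ⟨le_rfl, one_pos⟩
  refine (Real.continuous_exp.continuousOn.mul (S.init.continuousOn_tail.comp
    S.flow.continuousOn_foot_zero fun t ht => ?_)).congr fun t ht => S.w_eq ht h0
  have := S.flow.foot_mem le_rfl ht h0
  exact ⟨this.1, this.2.le⟩

theorem intervalIntegrable_w (ht : 0 ≤ t) (hx : x ∈ Icc (0 : ℝ) 1) (hy : y ∈ Icc (0 : ℝ) 1) :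
    IntervalIntegrable (fun x => w x t) MeasureTheory.volume x y := by
  have h1 : IntervalIntegrable (fun x => w x t) MeasureTheory.volume 0 1 :=
    intervalIntegral.intervalIntegrable_of_integral_ne_zero
      (by rw [S.sol.conservation t ht]; exact one_ne_zero)
  refine h1.mono_set ?_
  rw [uIcc_of_le (zero_le_one (α := ℝ))]
  exact ordConnected_Icc.uIcc_subset hx hy

/-- Conservation in the form `∫_0^1 (w(0,t) - w(x,t)) dx = w(0,t) - 1`, used as an upper bound. -/
theorem integral_le_of_le_sub (ht : 0 ≤ t) {u v : ℝ} (hu : 0 ≤ u) (huv : u ≤ v) (hv : v ≤ 1)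
    {g : ℝ → ℝ} (hg : IntervalIntegrable g MeasureTheory.volume u v)
    (hle : ∀ x ∈ Ioo u v, g x ≤ w 0 t - w x t) : ∫ x in u..v, g x ≤ w 0 t - 1 := by
  have h0 : (0 : ℝ) ∈ Ico (0 : ℝ) 1 := ⟨le_rfl, one_pos⟩
  have m0 : (0 : ℝ) ∈ Icc (0 : ℝ) 1 := ⟨le_rfl, zero_le_one⟩
  have m1 : (1 : ℝ) ∈ Icc (0 : ℝ) 1 := ⟨zero_le_one, le_rfl⟩
  have mu : u ∈ Icc (0 : ℝ) 1 := ⟨hu, huv.trans hv⟩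
  have mv : v ∈ Icc (0 : ℝ) 1 := ⟨hu.trans huv, hv⟩
  have hI : ∀ {a b : ℝ}, a ∈ Icc (0 : ℝ) 1 → b ∈ Icc (0 : ℝ) 1 →
      IntervalIntegrable (fun x => w 0 t - w x t) MeasureTheory.volume a b := fun ha hb =>
    intervalIntegrable_const.sub (S.intervalIntegrable_w ht ha hb)
  have hnn : ∀ {a b : ℝ}, 0 ≤ a → a ≤ b → b ≤ 1 → 0 ≤ ∫ x in a..b, (w 0 t - w x t) := by
    intro a b ha hab hb
    have := intervalIntegral.integral_mono_on_of_le_Ioo (f := fun _ => (0 : ℝ)) hab (by simp)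
      (hI ⟨ha, hab.trans hb⟩ ⟨ha.trans hab, hb⟩) fun x hx => sub_nonneg.2
        (S.antitoneOn_w ht h0 ⟨ha.trans hx.1.le, hx.2.trans_le hb⟩ (ha.trans hx.1.le))
    simpa using this
  have htot : ∫ x in (0 : ℝ)..1, (w 0 t - w x t) = w 0 t - 1 := by
    rw [intervalIntegral.integral_sub intervalIntegrable_const (S.intervalIntegrable_w ht m0 m1),
      S.sol.conservation t ht]
    simp
  have h1 := intervalIntegral.integral_add_adjacent_intervals (hI m0 mu) (hI mu m1)
  have h2 := intervalIntegral.integral_add_adjacent_intervals (hI mu mv) (hI mv m1)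
  have h3 := intervalIntegral.integral_mono_on_of_le_Ioo huv hg (hI mu mv) hle
  linarith [hnn le_rfl hu mu.2, hnn mv.1 hv le_rfl]

theorem sub_mul_le (ht : 0 ≤ t) (hx : x ∈ Ico (0 : ℝ) 1) :
    (w 0 t - w x t) * (1 - x) ≤ w 0 t - 1 := by
  have := S.integral_le_of_le_sub ht hx.1 hx.2.le le_rfl
    (intervalIntegrable_const (c := w 0 t - w x t)) fun z hz => ?_
  · rwa [intervalIntegral.integral_const, smul_eq_mul, mul_comm] at this
  · have := S.antitoneOn_w ht hx ⟨hx.1.trans hz.1.le, hz.2⟩ hz.1.le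
    simp only at this
    linarith

/-- The mass balance between the times `s` and `t`. -/
theorem mul_w_sub_one_le (hs : 0 ≤ s) (hst : s ≤ t) {σ : ℝ}
    (hσ : σ = 1 - Real.exp (-d1 φ 1 * (t - s) - -d1 ψ 1 * (cumul κ t - cumul κ s)))
    (hσ0 : 0 ≤ σ) : σ * (w σ s - 1) ≤ Real.exp (t - s) - 1 := by
  have ht := hs.trans hst
  set lam := Real.exp (-d1 φ 1 * (t - s) - -d1 ψ 1 * (cumul κ t - cumul κ s)) with hlam
  have hl0 : 0 < lam := Real.exp_pos _
  have hσ1 : σ < 1 := by linarith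
  have mσ : σ ∈ Icc (0 : ℝ) 1 := ⟨hσ0, hσ1.le⟩
  have m0 : (0 : ℝ) ∈ Icc (0 : ℝ) 1 := ⟨le_rfl, zero_le_one⟩
  have m1 : (1 : ℝ) ∈ Icc (0 : ℝ) 1 := ⟨zero_le_one, le_rfl⟩
  have hint : IntervalIntegrable (fun x => w (σ + lam * x) s) MeasureTheory.volume 0 1 := by
    have h1 := ((S.intervalIntegrable_w hs mσ m1).comp_add_left σ).comp_mul_left (c := lam)
    have h2 : (1 - σ) / lam = 1 := by rw [div_eq_one_iff_eq hl0.ne']; linarith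
    simpa [h2] using h1
  have h1 : ∫ x in (0 : ℝ)..1, w x t ≤
      ∫ x in (0 : ℝ)..1, Real.exp (t - s) * w (σ + lam * x) s := by
    refine intervalIntegral.integral_mono_on_of_le_Ioo zero_le_one
      (S.intervalIntegrable_w ht m0 m1) (hint.const_mul _) fun x hx => ?_
    have hx' : x ∈ Ico (0 : ℝ) 1 := ⟨hx.1.le, hx.2⟩
    have hf := S.flow.one_sub_foot_le hs hst hx'
    rw [← hlam] at hf
    rw [S.w_eq_exp_mul_foot hs hst hx']
    refine mul_le_mul_of_nonneg_left ?_ (Real.exp_pos _).le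
    have hlx : lam * x < lam := by nlinarith [hx.2]
    exact S.antitoneOn_w hs ⟨by nlinarith [hx.1], by linarith⟩ (S.flow.foot_mem hs hst hx')
      (by linarith)
  rw [S.sol.conservation t ht, intervalIntegral.integral_const_mul,
    intervalIntegral.integral_comp_add_mul (fun z => w z s) hl0.ne', smul_eq_mul, mul_zero, add_zero,
    mul_one, show σ + lam = 1 by linarith] at h1
  have h2 := intervalIntegral.integral_add_adjacent_intervals (S.intervalIntegrable_w hs m0 mσ)
    (S.intervalIntegrable_w hs mσ m1)
  rw [S.sol.conservation s hs] at h2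
  have h3 : σ * w σ s ≤ ∫ x in (0 : ℝ)..σ, w x s := by
    have := intervalIntegral.integral_mono_on_of_le_Ioo (f := fun _ => w σ s) hσ0
      intervalIntegrable_const (S.intervalIntegrable_w hs m0 mσ) fun x hx =>
      S.antitoneOn_w hs ⟨hx.1.le, hx.2.trans hσ1⟩ ⟨hσ0, hσ1⟩ hx.2.le
    rwa [intervalIntegral.integral_const, smul_eq_mul, sub_zero] at this
  have hE : 1 ≤ Real.exp (t - s) := Real.one_le_exp (by linarith)
  have h4 : lam ≤ Real.exp (t - s) * (1 - σ * w σ s) := by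
    have : lam ≤ Real.exp (t - s) * ∫ x in σ..1, w x s := by
      calc lam = lam * 1 := (mul_one _).symm
        _ ≤ lam * (Real.exp (t - s) * (lam⁻¹ * ∫ x in σ..1, w x s)) := by gcongr
        _ = _ := by field_simp
    refine this.trans ?_
    gcongr
    linarith
  have h5 : 0 ≤ σ * w σ s := mul_nonneg hσ0 (S.w_pos hs ⟨hσ0, hσ1⟩).le
  nlinarith

end SolutionData

/-! ### Lower bounds for the outflow value -/

namespace SolutionData

variable {φ ψ c₀ κ : ℝ → ℝ} {K : NNReal} {w : ℝ → ℝ → ℝ}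

/-- While the characteristic that exits at time `s` started away from `1`, the time `s` is bounded
and the solution cannot have concentrated at `x = 1`. -/
theorem exists_lower_bound_of_foot_le (hc : IsInitialDensity c₀) {l : ℝ} (hl : l ∈ Ico (0 : ℝ) 1) :
    ∃ δ : ℝ, 0 < δ ∧ ∀ (w : ℝ → ℝ → ℝ) (κ : ℝ → ℝ), SolutionData φ ψ K c₀ w κ → ∀ s, 0 ≤ s →
      foot φ ψ κ 0 s 0 ≤ l → w 0 s ≤ 2 → δ ≤ w 0 s - 1 := by
  have hwl := hc.tail_pos l hl
  obtain ⟨l', hl', hwl'⟩ : ∃ l' ∈ Icc l 1, tail c₀ l' = tail c₀ l / 2 := by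
    refine intermediate_value_Icc' hl.2.le (hc.continuousOn_tail.mono
      (Icc_subset_Icc_left hl.1)) ⟨?_, by linarith⟩
    rw [tail_one]
    positivity
  have hl'1 : l' < 1 := lt_of_le_of_ne hl'.2 fun e => by
    rw [e, tail_one] at hwl'
    linarith
  have hl'0 : 0 ≤ l' := hl.1.trans hl'.1
  set T := 2 / tail c₀ l with hT
  have hT0 : 0 < T := by positivity
  refine ⟨tail c₀ l / 2 * ((1 - l') / T), by
    have : 0 < 1 - l' := by linarith
    positivity, fun w κ S s hs hfoot hm => ?_⟩
  have h0 : (0 : ℝ) ∈ Ico (0 : ℝ) 1 := ⟨le_rfl, one_pos⟩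
  have hf0 := S.flow.foot_mem le_rfl hs h0
  have hw0 : tail c₀ l ≤ tail c₀ (foot φ ψ κ 0 s 0) :=
    hc.antitoneOn_tail ⟨hf0.1, hf0.2.le⟩ ⟨hl.1, hl.2.le⟩ hfoot
  have hw := S.w_eq hs h0
  have hexp : Real.exp s ≤ T := by
    rw [hT, le_div_iff₀ hwl]
    have : Real.exp s * tail c₀ l ≤ Real.exp s * tail c₀ (foot φ ψ κ 0 s 0) := by gcongr
    linarith
  have hexp1 : 1 ≤ Real.exp s := Real.one_le_exp hs
  have hx : 1 - (1 - l') / T ∈ Ico (0 : ℝ) 1 := by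
    have h1 : 0 < (1 - l') / T := div_pos (by linarith) hT0
    have h2 : (1 - l') / T ≤ 1 := (div_le_one hT0).2 (by linarith)
    exact ⟨by linarith, by linarith⟩
  have hfx := S.flow.foot_mem le_rfl hs hx
  have hl'f : l' ≤ foot φ ψ κ 0 s (1 - (1 - l') / T) := by
    have h1 := S.flow.one_sub_foot_le le_rfl hs hx
    have h2 : Real.exp (-d1 φ 1 * (s - 0) - -d1 ψ 1 * (cumul κ s - cumul κ 0)) ≤ T := by
      refine le_trans (Real.exp_le_exp.2 ?_) hexp
      have h3 := (strictMono_cumul S.flow.κ_cont S.flow.κ_pos).monotone hs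
      have h4 := mul_nonneg S.flow.coeff.b_pos.le (sub_nonneg.2 h3)
      have h5 := S.flow.coeff.φ_slope_gt
      nlinarith
    have h6 : 1 - (1 - (1 - l') / T) = (1 - l') / T := by ring
    rw [h6] at h1
    have h7 : (1 - l') / T * T = 1 - l' := div_mul_cancel₀ _ hT0.ne'
    have h8 : 0 ≤ (1 - l') / T := div_nonneg (by linarith) hT0.le
    nlinarith
  have hwx := S.w_eq hs hx
  have h1 : tail c₀ (foot φ ψ κ 0 s (1 - (1 - l') / T)) ≤ tail c₀ l / 2 := by
    rw [← hwl']
    exact hc.antitoneOn_tail ⟨hl'0, hl'1.le⟩ ⟨hfx.1, hfx.2.le⟩ hl'f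
  have h2 : tail c₀ l / 2 ≤ w 0 s - w (1 - (1 - l') / T) s := by
    rw [hw, hwx, ← mul_sub]
    nlinarith
  have h3 := S.sub_mul_le hs hx
  have h4 : 1 - (1 - (1 - l') / T) = (1 - l') / T := by ring
  rw [h4] at h3
  refine le_trans ?_ h3
  exact mul_le_mul_of_nonneg_right h2 (div_nonneg (by linarith) hT0.le)

theorem integral_inv_one_sub {u v : ℝ} (huv : u ≤ v) (hv : v < 1) :
    ∫ x in u..v, (1 - x)⁻¹ = Real.log ((1 - u) / (1 - v)) := by
  rw [intervalIntegral.integral_comp_sub_left (fun x => x⁻¹), integral_inv_of_pos] <;> linarith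

variable (S : SolutionData φ ψ K c₀ w κ) {s t : ℝ}
include S

/-- The logarithmic gain. By convexity of the backward flow and the comparison of slopes of `w₀`, a
drop `d` of `w(·, s)` on `[0, y]` forces a drop of at least a constant times `d / (y (1 - x))` on
`[0, x]`, for every `x` close to `1` with `w(x, s)` close to `w(0, s)`. Integrating over these
`x` produces a logarithm, which is large when `w(0, s) - 1` is small. -/
theorem log_mul_drop_le {l q e δ : ℝ} (hq : 0 < q)
    (hslope : ∀ x y z, l ≤ x → x ≤ y → y ≤ z → z < 1 → 9 / 10 * tail c₀ x ≤ tail c₀ z →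
      q * (expCoord ψ z - expCoord ψ y) * (tail c₀ x - tail c₀ y) ≤
        (tail c₀ y - tail c₀ z) * (expCoord ψ y - expCoord ψ x))
    (he : 0 < e) (he1 : e ≤ 1) (hE : ∀ x ∈ Ico (0 : ℝ) 1, e / (1 - x) ≤ expCoord ψ x)
    (hδ : 0 < δ) (hδe : δ ≤ e / 40) (hs : 0 ≤ s) (hfoot : l ≤ foot φ ψ κ 0 s 0)
    (hm : w 0 s - 1 ≤ δ) {y : ℝ} (hy : y ∈ Ioc (0 : ℝ) (1 / 2)) :
    q * e / 8 * Real.log (e / (40 * δ)) * (w 0 s - w y s) ≤ y * (w 0 s - 1) := by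
  have hcoef := S.flow.coeff
  have hc := S.init
  have h0 : (0 : ℝ) ∈ Ico (0 : ℝ) 1 := ⟨le_rfl, one_pos⟩
  have hyI : y ∈ Ico (0 : ℝ) 1 := ⟨hy.1.le, by linarith [hy.2]⟩
  have hm1 : 1 ≤ w 0 s := by
    have := S.sub_mul_le hs h0
    linarith
  have hdrop0 : 0 ≤ w 0 s - w y s := sub_nonneg.2 (S.antitoneOn_w hs h0 hyI hy.1.le)
  have hmem := fun z hz => S.flow.foot_mem (x := z) le_rfl hs hz
  have hmono := S.flow.monotoneOn_foot le_rfl hs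
  have hEy : expCoord ψ y - 1 ≤ 4 * y := by
    have h1 := hcoef.expCoord_sub_le le_rfl hy.1.le hyI.2
    rw [expCoord_zero, sub_zero] at h1
    refine h1.trans ?_
    have h2 : 1 / (1 - y) ^ 2 ≤ 4 := by
      rw [div_le_iff₀ (by nlinarith [hy.2])]
      nlinarith [hy.2]
    nlinarith [hy.1]
  have hEy1 : 0 < expCoord ψ y - 1 := by
    have := hcoef.strictMonoOn_expCoord (by simp : (0 : ℝ) ∈ Iio 1) hyI.2 hy.1
    rw [expCoord_zero] at this
    linarith
  have hEy2 : expCoord ψ y ≤ 2 := by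
    refine (hcoef.expCoord_le hyI).trans ?_
    rw [div_le_iff₀ (by linarith [hyI.2])]
    linarith [hy.2]
  have key : ∀ x ∈ Ioo (1 - e / 4) (1 - 10 * δ),
      q * e / 8 * (w 0 s - w y s) / y * (1 - x)⁻¹ ≤ w 0 s - w x s := by
    intro x hx
    have hx34 : 3 / 4 ≤ x := by linarith [hx.1]
    have hxI : x ∈ Ico (0 : ℝ) 1 := ⟨by linarith, by linarith [hx.2]⟩
    have hux : 0 < 1 - x := by linarith [hxI.2]
    have hyx : y < x := by linarith [hy.2]
    -- conservation forces `w(x, s)` to be close to `w(0, s)`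
    have hwx : 9 / 10 * w 0 s ≤ w x s := by
      have h1 := (S.sub_mul_le hs hxI).trans hm
      by_contra! hlt
      nlinarith [hx.2]
    rw [S.w_eq hs h0, S.w_eq hs hxI] at hwx
    have hw9 : 9 / 10 * tail c₀ (foot φ ψ κ 0 s 0) ≤ tail c₀ (foot φ ψ κ 0 s x) :=
      le_of_mul_le_mul_left (by linarith) (Real.exp_pos s)
    have h01 := hmono h0 hyI hy.1.le
    have h12 := hmono hyI hxI hyx.le
    have hsl := hslope _ _ _ hfoot h01 h12 (hmem x hxI).2 hw9
    have hcv := S.flow.foot_convex le_rfl hs le_rfl hy.1.le hyx hxI.2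
    rw [expCoord_zero] at hcv
    set z₁ := foot φ ψ κ 0 s 0
    set z₂ := foot φ ψ κ 0 s y
    set z₃ := foot φ ψ κ 0 s x
    have hd12 : 0 ≤ tail c₀ z₁ - tail c₀ z₂ := sub_nonneg.2 (hc.antitoneOn_tail
      ⟨(hmem 0 h0).1, (hmem 0 h0).2.le⟩ ⟨(hmem y hyI).1, (hmem y hyI).2.le⟩ h01)
    have hd23 : 0 ≤ tail c₀ z₂ - tail c₀ z₃ := sub_nonneg.2 (hc.antitoneOn_tail
      ⟨(hmem y hyI).1, (hmem y hyI).2.le⟩ ⟨(hmem x hxI).1, (hmem x hxI).2.le⟩ h12)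
    have hEx : e / 2 / (1 - x) ≤ expCoord ψ x - expCoord ψ y := by
      have h1 := hE x hxI
      have h2 : 2 ≤ e / 2 / (1 - x) := by
        rw [le_div_iff₀ hux]
        linarith [hx.1]
      have h3 : e / (1 - x) = e / 2 / (1 - x) + e / 2 / (1 - x) := by ring
      linarith
    have hEx0 : 0 ≤ expCoord ψ x - expCoord ψ y := (by positivity : (0 : ℝ) ≤ _).trans hEx
    have hmain : q * (expCoord ψ x - expCoord ψ y) * (tail c₀ z₁ - tail c₀ z₂) ≤
        (tail c₀ z₂ - tail c₀ z₃) * (expCoord ψ y - 1) := by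
      rcases h01.eq_or_lt with heq | hlt
      · rw [heq, sub_self, mul_zero]
        exact mul_nonneg hd23 hEy1.le
      · have hE12 : 0 < expCoord ψ z₂ - expCoord ψ z₁ :=
          sub_pos.2 (hcoef.strictMonoOn_expCoord (hmem 0 h0).2 (hmem y hyI).2 hlt)
        have hcv' : (expCoord ψ z₂ - expCoord ψ z₁) * (expCoord ψ x - expCoord ψ y) ≤
            (expCoord ψ y - 1) * (expCoord ψ z₃ - expCoord ψ z₂) := by linarith
        refine le_of_mul_le_mul_left ?_ hE12
        calc (expCoord ψ z₂ - expCoord ψ z₁) *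
              (q * (expCoord ψ x - expCoord ψ y) * (tail c₀ z₁ - tail c₀ z₂))
            = q * (tail c₀ z₁ - tail c₀ z₂) *
              ((expCoord ψ z₂ - expCoord ψ z₁) * (expCoord ψ x - expCoord ψ y)) := by ring
          _ ≤ q * (tail c₀ z₁ - tail c₀ z₂) *
              ((expCoord ψ y - 1) * (expCoord ψ z₃ - expCoord ψ z₂)) := by gcongr
          _ = (expCoord ψ y - 1) *
              (q * (expCoord ψ z₃ - expCoord ψ z₂) * (tail c₀ z₁ - tail c₀ z₂)) := by ring
          _ ≤ (expCoord ψ y - 1) *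
              ((tail c₀ z₂ - tail c₀ z₃) * (expCoord ψ z₂ - expCoord ψ z₁)) := by gcongr
          _ = _ := by ring
    have hw12 : w 0 s - w y s = Real.exp s * (tail c₀ z₁ - tail c₀ z₂) := by
      rw [S.w_eq hs h0, S.w_eq hs hyI]; ring
    have hw13 : Real.exp s * (tail c₀ z₂ - tail c₀ z₃) ≤ w 0 s - w x s := by
      rw [S.w_eq hs h0, S.w_eq hs hxI, ← mul_sub]
      gcongr
      linarith
    have hfin : q * (e / 2 / (1 - x)) * (w 0 s - w y s) ≤ (w 0 s - w x s) * (4 * y) := by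
      have hy0 := hy.1.le
      calc q * (e / 2 / (1 - x)) * (w 0 s - w y s)
          ≤ q * (expCoord ψ x - expCoord ψ y) * (w 0 s - w y s) := by gcongr
        _ = Real.exp s * (q * (expCoord ψ x - expCoord ψ y) * (tail c₀ z₁ - tail c₀ z₂)) := by
            rw [hw12]; ring
        _ ≤ Real.exp s * ((tail c₀ z₂ - tail c₀ z₃) * (expCoord ψ y - 1)) := by gcongr
        _ = Real.exp s * (tail c₀ z₂ - tail c₀ z₃) * (expCoord ψ y - 1) := by ring
        _ ≤ Real.exp s * (tail c₀ z₂ - tail c₀ z₃) * (4 * y) := by gcongr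
        _ ≤ (w 0 s - w x s) * (4 * y) := by gcongr
    have hy0 := hy.1
    rw [← div_le_iff₀ (by positivity)] at hfin
    refine le_trans (le_of_eq ?_) hfin
    field_simp
    ring
  have huv : 1 - e / 4 ≤ 1 - 10 * δ := by linarith
  have hint : IntervalIntegrable (fun x => q * e / 8 * (w 0 s - w y s) / y * (1 - x)⁻¹)
      MeasureTheory.volume (1 - e / 4) (1 - 10 * δ) := by
    refine ContinuousOn.intervalIntegrable ?_
    rw [uIcc_of_le huv]
    refine continuousOn_const.mul (ContinuousOn.inv₀ (by fun_prop) fun x hx => ?_)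
    have := hx.2
    exact (by linarith : (0 : ℝ) < 1 - x).ne'
  have h1 := S.integral_le_of_le_sub hs (by linarith) huv (by linarith) hint key
  rw [intervalIntegral.integral_const_mul, integral_inv_one_sub huv (by linarith),
    show (1 - (1 - e / 4)) / (1 - (1 - 10 * δ)) = e / (40 * δ) by field_simp; ring] at h1
  have hy0 := hy.1
  calc q * e / 8 * Real.log (e / (40 * δ)) * (w 0 s - w y s)
      = y * (q * e / 8 * (w 0 s - w y s) / y * Real.log (e / (40 * δ))) := by field_simp
    _ ≤ y * (w 0 s - 1) := by gcongr

/-- The mass balance bounds `∫_s^t κ` as long as `w(·, s)` exceeds `1` near `x = 0`. -/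
theorem cumul_sub_mul_le {σ₀ c : ℝ} (hs : 0 ≤ s) (hst : s ≤ t) (ht1 : t - s ≤ 1) (hc : 0 ≤ c)
    (hσ₀ : σ₀ ≤ 1 / 2) (hw : ∀ σ ∈ Icc 0 σ₀, c ≤ w σ s - 1)
    (hk : -d1 ψ 1 * (cumul κ t - cumul κ s) ≤ σ₀) :
    (-d1 ψ 1 * (cumul κ t - cumul κ s) - -d1 φ 1 * (t - s)) * c ≤ 4 * (t - s) := by
  have hτ : 0 ≤ t - s := sub_nonneg.2 hst
  set v := -d1 ψ 1 * (cumul κ t - cumul κ s) - -d1 φ 1 * (t - s) with hv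
  rcases le_total v 0 with hv0 | hv0
  · have := mul_nonpos_of_nonpos_of_nonneg hv0 hc
    linarith
  have haτ : 0 ≤ -d1 φ 1 * (t - s) :=
    mul_nonneg (by linarith [S.flow.coeff.φ_slope_neg]) hτ
  have hvσ : v ≤ σ₀ := by linarith
  have h1 : 1 - Real.exp (-v) ≤ v := by linarith [Real.add_one_le_exp (-v)]
  have h2 : v / 2 ≤ 1 - Real.exp (-v) := by
    have h3 : Real.exp (-v) ≤ 1 / (1 + v) := by
      rw [Real.exp_neg, ← one_div]
      exact one_div_le_one_div_of_le (by linarith) (by linarith [Real.add_one_le_exp v])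
    have h4 : 1 / (1 + v) ≤ 1 - v / 2 := by
      rw [div_le_iff₀ (by linarith)]
      nlinarith
    linarith
  have h5 := S.mul_w_sub_one_le hs hst (σ := 1 - Real.exp (-v))
    (by rw [hv, neg_sub]) (by linarith)
  have h6 := hw (1 - Real.exp (-v)) ⟨by linarith, h1.trans hvσ⟩
  have h7 : Real.exp (t - s) - 1 ≤ 2 * (t - s) := by
    have := (le_abs_self _).trans (Real.abs_exp_sub_one_le (x := t - s) (by rwa [abs_of_nonneg hτ]))
    rwa [abs_of_nonneg hτ] at this
  have h8 : v / 2 * c ≤ (1 - Real.exp (-v)) * (w (1 - Real.exp (-v)) s - 1) := by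
    gcongr
    linarith
  linarith

/-- If the drop of `w(·, s)` near `x = 0` is small compared to `w(0, s) - 1`, then `w(0, ·)` does
not decrease immediately after time `s`. -/
theorem eventually_w_zero_ge (hs : 0 ≤ s) (hm1 : 1 ≤ w 0 s) (hm2 : w 0 s ≤ 2)
    (hdrop : ∀ y ∈ Ioc (0 : ℝ) (1 / 2),
      w 0 s - w y s ≤ -d1 ψ 1 / (18 * ψ 0) * y * (w 0 s - 1)) :
    ∀ᶠ t in 𝓝[>] s, w 0 s ≤ w 0 t := by
  have hcoef := S.flow.coeff
  have hb := hcoef.b_pos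
  have hψ0 := hcoef.ψ_zero_pos
  have hbψ := hcoef.b_le
  have h0 : (0 : ℝ) ∈ Ico (0 : ℝ) 1 := ⟨le_rfl, one_pos⟩
  have hcc : ContinuousAt (fun t => ψ 0 * (cumul κ t - cumul κ s)) s :=
    continuousAt_const.mul
      ((hasDerivAt_cumul S.flow.κ_cont s).continuousAt.sub continuousAt_const)
  have hev : ∀ᶠ t in 𝓝 s, ψ 0 * (cumul κ t - cumul κ s) < 1 / 2 :=
    hcc.eventually_lt continuousAt_const (by simp)
  filter_upwards [nhdsWithin_le_nhds hev, Ioo_mem_nhdsGT (lt_add_one s)] with t hkt htI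
  have hst : s ≤ t := htI.1.le
  have hτ : 0 ≤ t - s := sub_nonneg.2 hst
  have hτ1 : t - s ≤ 1 := by linarith [htI.2]
  have hk0 : 0 ≤ cumul κ t - cumul κ s :=
    sub_nonneg.2 ((strictMono_cumul S.flow.κ_cont S.flow.κ_pos).monotone hst)
  set k := cumul κ t - cumul κ s with hk
  have hratio : -d1 ψ 1 / (18 * ψ 0) ≤ 1 / 18 := by
    rw [div_le_div_iff₀ (by positivity) (by norm_num)]
    linarith
  have hratio0 : 0 ≤ -d1 ψ 1 / (18 * ψ 0) := by positivity
  have hmm : 0 ≤ w 0 s - 1 := by linarith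
  have hcum := S.cumul_sub_mul_le (σ₀ := 1 / 2) (c := (w 0 s - 1) / 2) hs hst hτ1 (by linarith)
    le_rfl ?_ (by rw [← hk]; nlinarith)
  · have hbk : -d1 ψ 1 * k * (w 0 s - 1) ≤ 9 * (t - s) := by
      have ha1 : -d1 φ 1 * (t - s) * (w 0 s - 1) ≤ 1 * (t - s) * 1 := by
        have := hcoef.φ_slope_gt
        gcongr <;> linarith
      rw [← hk] at hcum
      linarith
    have hf := S.flow.foot_mem hs hst h0
    have hfle := S.flow.foot_le hs hst h0
    rw [zero_add, ← hk] at hfle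
    have hloss : w 0 s - w (foot φ ψ κ s t 0) s ≤ (t - s) / 2 := by
      rcases hf.1.eq_or_lt with heq | hlt
      · rw [← heq, sub_self]; linarith
      · refine (hdrop _ ⟨hlt, by linarith⟩).trans ?_
        calc -d1 ψ 1 / (18 * ψ 0) * foot φ ψ κ s t 0 * (w 0 s - 1)
            ≤ -d1 ψ 1 / (18 * ψ 0) * (ψ 0 * k) * (w 0 s - 1) := by gcongr
          _ = -d1 ψ 1 * k * (w 0 s - 1) / 18 := by
              generalize -d1 ψ 1 = b
              field_simp
          _ ≤ (t - s) / 2 := by linarith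
    rw [S.w_eq_exp_mul_foot hs hst h0]
    have hexp := Real.add_one_le_exp (t - s)
    have hwf : w 0 s - (t - s) / 2 ≤ w (foot φ ψ κ s t 0) s := by linarith
    calc w 0 s ≤ (t - s + 1) * (w 0 s - (t - s) / 2) := by nlinarith
      _ ≤ Real.exp (t - s) * w (foot φ ψ κ s t 0) s := by
          refine mul_le_mul hexp hwf (by linarith) (Real.exp_pos _).le
  · intro σ hσ
    rcases hσ.1.eq_or_lt with heq | hlt
    · rw [← heq]; linarith
    · have h1 := hdrop σ ⟨hlt, hσ.2⟩
      have h2 : -d1 ψ 1 / (18 * ψ 0) * σ ≤ 1 / 18 * (1 / 2) := by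
        have := hσ.2
        gcongr
      nlinarith

/-- A lower bound for `w(0, s) - 1` bounds the rate `κ(s)`. -/
theorem κ_le_of_le_w_zero {δ : ℝ} (hδ : 0 < δ) (hs : 0 ≤ s) (hm : 1 + δ ≤ w 0 s) :
    κ s ≤ (-d1 φ 1 + 8 / δ) / (-d1 ψ 1) := by
  have hb := S.flow.coeff.b_pos
  have h0 : (0 : ℝ) ∈ Ico (0 : ℝ) 1 := ⟨le_rfl, one_pos⟩
  have hev : ∀ᶠ σ in 𝓝[≥] (0 : ℝ), 1 + δ / 2 < w σ s := by
    have h1 := S.continuousOn_w hs 0 h0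
    have h2 : 𝓝[≥] (0 : ℝ) = 𝓝[Ico 0 1] 0 := (nhdsWithin_Ico_eq_nhdsGE one_pos).symm
    rw [h2]
    exact h1 (lt_mem_nhds (by linarith))
  obtain ⟨u, hu0, hu⟩ := mem_nhdsGE_iff_exists_Icc_subset.1 hev
  have hu0' : (0 : ℝ) < u := hu0
  have hcd := hasDerivAt_cumul S.flow.κ_cont s
  have hk : ∀ᶠ t in 𝓝 s, -d1 ψ 1 * (cumul κ t - cumul κ s) < min u (1 / 2) := by
    have hcc : ContinuousAt (fun t => -d1 ψ 1 * (cumul κ t - cumul κ s)) s :=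
      continuousAt_const.mul (hcd.continuousAt.sub continuousAt_const)
    exact hcc.eventually_lt continuousAt_const (by simp [hu0'])
  have hsl := (hasDerivWithinAt_iff_tendsto_slope' self_notMem_Ioi).1
    (hcd.hasDerivWithinAt (s := Ioi s))
  rw [max_eq_left hs] at hsl
  refine le_of_tendsto hsl ?_
  filter_upwards [nhdsWithin_le_nhds hk, Ioo_mem_nhdsGT (lt_add_one s)] with t hkt htI
  have hτ : 0 < t - s := sub_pos.2 htI.1
  have h1 := S.cumul_sub_mul_le (c := δ / 2) hs htI.1.le (by linarith [htI.2]) (by linarith)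
    (min_le_right u (1 / 2)) (fun σ hσ => by
      have : 1 + δ / 2 < w σ s := hu ⟨hσ.1, hσ.2.trans (min_le_left _ _)⟩
      linarith) hkt.le
  rw [slope_def_field, div_le_div_iff₀ hτ hb]
  have h2 : -d1 ψ 1 * (cumul κ t - cumul κ s) - -d1 φ 1 * (t - s) ≤ 8 / δ * (t - s) := by
    rw [div_mul_eq_mul_div, le_div_iff₀ hδ]
    linarith
  linarith

/-- If `w(0, ·)` does not decrease immediately after it takes the value `1 + δ`, then it never falls
below this value. -/
theorem le_w_zero {δ : ℝ} (hinit : 1 + δ ≤ w 0 0)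
    (hstep : ∀ s, 0 ≤ s → w 0 s = 1 + δ → ∀ᶠ t in 𝓝[>] s, w 0 s ≤ w 0 t) (ht : 0 ≤ t) :
    1 + δ ≤ w 0 t := by
  have hcont : ContinuousOn (fun r => w 0 r) (Icc 0 t) :=
    S.continuousOn_w_zero.mono Icc_subset_Ici_self
  have hclosed : IsClosed ({r | 1 + δ ≤ w 0 r} ∩ Icc 0 t) := by
    rw [inter_comm]
    exact hcont.preimage_isClosed_of_isClosed isClosed_Icc isClosed_Ici
  refine hclosed.Icc_subset_of_forall_exists_gt hinit ?_ (right_mem_Icc.2 ht)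
  intro r hr z hz
  have hr0 : 0 ≤ r := hr.2.1
  have hev : ∀ᶠ q in 𝓝[>] r, 1 + δ ≤ w 0 q := by
    rcases (show 1 + δ ≤ w 0 r from hr.1).eq_or_lt with heq | hlt
    · filter_upwards [hstep r hr0 heq.symm] with q hq
      linarith
    · have h1 : ContinuousWithinAt (fun r => w 0 r) (Ioi r) r :=
        (S.continuousOn_w_zero r hr0).mono fun q hq => hr0.trans (le_of_lt hq)
      filter_upwards [h1 (lt_mem_nhds hlt)] with q hq
      exact le_of_lt hq
  obtain ⟨q, hq, hqz⟩ := (hev.and (Ioc_mem_nhdsGT hz)).exists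
  exact ⟨q, hq, hqz⟩

end SolutionData

end LSW

theorem proposition6p2 (φ ψ : ℝ → ℝ) (hφψ : LSW.IsCoefficientPair φ ψ)
    (hΓ : AntitoneOn (LSW.Gam φ ψ) (Set.Ioo 0 1))
    (hφ0 : ∃ L : ℝ, Filter.Tendsto (fun x => φ x / x) (nhdsWithin 0 (Set.Ioi 0)) (nhds L))
    (c₀ : ℝ → ℝ) (hc₀ : LSW.IsInitialDensity c₀)
    (hβ : Filter.Tendsto (LSW.betaFn c₀) (nhdsWithin 1 (Set.Iio 1)) (nhds 1)) :
    ∃ C : ℝ, ∀ (w : ℝ → ℝ → ℝ) (κ : ℝ → ℝ),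
      LSW.IsSolution φ ψ (LSW.tail c₀) w κ → ∀ t : ℝ, 0 ≤ t → κ t ≤ C := by
  obtain ⟨K, hK⟩ := hφψ.exists_lipschitz_speed hφ0
  obtain ⟨l, hl, q, hq, hslope⟩ := hc₀.exists_slope_comparison hφψ hβ
  obtain ⟨e, he, he1, hE⟩ := hφψ.exists_le_expCoord
  obtain ⟨δ₁, hδ₁, hfar⟩ :=
    LSW.SolutionData.exists_lower_bound_of_foot_le (φ := φ) (ψ := ψ) (K := K) hc₀ hl
  have hb := hφψ.b_pos
  have hψ0 := hφψ.ψ_zero_pos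
  have hm0 := hc₀.one_lt_tail_zero
  -- `ε` is the ratio required by `eventually_w_zero_ge`; `δ` is so small that the logarithmic gain
  -- reaches `1 / ε`
  set ε : ℝ := -LSW.d1 ψ 1 / (18 * ψ 0) with hε
  have hε0 : 0 < ε := by positivity
  set δ : ℝ := min (min (e / 40 * Real.exp (-(8 / (q * e * ε)))) (δ₁ / 2))
    (min 1 (LSW.tail c₀ 0 - 1)) with hδdef
  have hδ : 0 < δ := by
    refine lt_min (lt_min (by positivity) (by positivity)) (lt_min one_pos (by linarith))
  have hδ1 : δ ≤ e / 40 * Real.exp (-(8 / (q * e * ε))) :=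
    (min_le_left _ _).trans (min_le_left _ _)
  have hδ2 : δ ≤ δ₁ / 2 := (min_le_left _ _).trans (min_le_right _ _)
  have hδ3 : δ ≤ 1 := (min_le_right _ _).trans (min_le_left _ _)
  have hδ4 : δ ≤ LSW.tail c₀ 0 - 1 := (min_le_right _ _).trans (min_le_right _ _)
  have hδe : δ ≤ e / 40 := by
    refine hδ1.trans (mul_le_of_le_one_right (by positivity) (Real.exp_le_one_iff.2 ?_))
    simp only [Left.neg_nonpos_iff]
    positivity
  have hlog : 8 / (q * e * ε) ≤ Real.log (e / (40 * δ)) := by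
    rw [Real.le_log_iff_exp_le (by positivity), le_div_iff₀ (by positivity)]
    rw [Real.exp_neg] at hδ1
    have hX := Real.exp_pos (8 / (q * e * ε))
    calc Real.exp (8 / (q * e * ε)) * (40 * δ)
        ≤ Real.exp (8 / (q * e * ε)) * (40 * (e / 40 * (Real.exp (8 / (q * e * ε)))⁻¹)) := by
          gcongr
      _ = e := by field_simp
  refine ⟨(-LSW.d1 φ 1 + 8 / δ) / (-LSW.d1 ψ 1), fun w κ hsol t ht => ?_⟩
  have S : LSW.SolutionData φ ψ K c₀ w κ :=
    ⟨⟨hφψ, hΓ, hK, hsol.κ_continuousOn, hsol.κ_pos⟩, hc₀, hsol⟩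
  refine S.κ_le_of_le_w_zero hδ ht (S.le_w_zero ?_ (fun s hs hms => ?_) ht)
  · rw [hsol.initial 0 ⟨le_rfl, one_pos⟩]
    linarith
  · have hfoot : l ≤ LSW.foot φ ψ κ 0 s 0 := by
      by_contra! hlt
      have := hfar w κ S s hs hlt.le (by linarith)
      linarith
    refine S.eventually_w_zero_ge hs (by linarith) (by linarith) fun y hy => ?_
    have h1 := S.log_mul_drop_le hq hslope he he1 hE hδ hδe hs hfoot (by linarith) hy
    have hd0 : 0 ≤ w 0 s - w y s := sub_nonneg.2 (S.antitoneOn_w hs ⟨le_rfl, one_pos⟩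
      ⟨hy.1.le, by linarith [hy.2]⟩ hy.1.le)
    have h2 : 1 / ε * (w 0 s - w y s) ≤ y * (w 0 s - 1) := by
      refine le_trans ?_ h1
      gcongr
      calc 1 / ε = q * e / 8 * (8 / (q * e * ε)) := by field_simp
        _ ≤ _ := by gcongr
    rw [one_div, inv_mul_le_iff₀ hε0] at h2
    linarith
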